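/- Let $H$ be a finite-dimensional complex linear space. A linear relation in $H$ is a subspace $A\subset H\times H$; let $\operatorname{dom}A,\operatorname{ran}A,\ker A,\operatorname{mul}A$ be its domain, range, kernel and multivalued part, $A-\lambda=\{(x,y-\lambda x):(x,y)\in A\}$, and $A^k$ its powers ($A^0=I$). Put $$\mathfrak R_\lambda(A)=\operatorname{span}\bigcup_i\ker(A-\lambda)^i\ (\lambda\in\mathbb C),\quad \mathfrak R_\infty(A)=\operatorname{span}\bigcup_i\operatorname{mul}A^i,\quad \mathfrak R_r(A)=\operatorname{span}\bigcup_{\lambda\in\mathbb C\cup\{\infty\}}\mathfrak R_\lambda(A),\quad \mathfrak R_c(A)=\mathfrak R_0(A)\cap\mathfrak R_\infty(A).$$ The point spectrum $\sigma_p(A)$ consists of the $\lambda\in\mathbb C$ with $\ker(A-\lambda)\ne\{0\}$ and of $\infty$ if $\operatorname{mul}A\neq\{0\}$; the set of proper eigenvalues is $\sigma_\pi(A)=\{\lambda\in\sigma_p(A):\mathfrak R_\lambda(A)\not\subset\mathfrak R_c(A)\}$. The Weyr characteristic of $A$ consists of the sequences $$B_k=\dim\frac{\ker A^k\cap\mathfrak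 R_c(A)}{\ker A^{k-1}\cap\mathfrak R_c(A)},\qquad W_k(\lambda)=\dim\frac{\ker(A-\lambda)^k+\mathfrak R_c(A)}{\ker(A-\lambda)^{k-1}+\mathfrak R_c(A)},\qquad A_k=\dim\frac{\operatorname{mul}A^k+\mathfrak R_c(A)}{\operatorname{mul}A^{k-1}+\mathfrak R_c(A)}\qquad(k\ge1),$$ $$C_0=\dim\frac{\operatorname{dom}A+\operatorname{ran}A}{\operatorname{ran}A+\mathfrak R_r(A)},\qquad C_k=\dim\frac{\operatorname{ran}A^k+\mathfrak R_r(A)}{\operatorname{ran}A^{k+1}+\mathfrak R_r(A)}\quad(k\ge1),$$ where the sequences $W(\lambda)$ are recorded together with the points $\lambda\in\mathbb C$ to which they belong ($W(\lambda)$ is the null sequence unless $\lambda\in\sigma_\pi(A)$). Consider finitely many chains, each of one of four types and consisting of $n\ge1$ vectors $x_1,\dots,x_n\in H$. The pairs of a chain are * singular chain: $(0,x_n),(x_n,x_{n-1}),\dots,(x_2,x_1),(x_1,0)$; * Jordan chain at $\lambda\in\mathbb C$: $(x_n,x_{n-1}+\lambda x_n),\dots,(x_2,x_1+\lambda x_2),(x_1,\lambda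 x_1)$; * Jordan chain at $\infty$: $(0,x_1),(x_1,x_2),\dots,(x_{n-1},x_n)$; * shift chain: $(x_1,x_2),\dots,(x_{n-1},x_n)$. Such a system of chains is a Jordan-like decomposition of $A$ if all its vectors together are linearly independent, the vectors of its singular chains span $\mathfrak R_c(A)$, and, with $\mathfrak X_\lambda$, $\mathfrak X_\infty$, $\mathfrak R_m$ the spans of the vectors of its Jordan chains at $\lambda\in\mathbb C$, of its Jordan chains at $\infty$ and of its shift chains, one has the direct sums $$\operatorname{dom}A+\operatorname{ran}A=\mathfrak R_c(A)\oplus\bigoplus_{\lambda\in\mathbb C}\mathfrak X_\lambda\oplus\mathfrak X_\infty\oplus\mathfrak R_m,\qquad A=A_S\oplus\bigoplus_{\lambda\in\mathbb C} J_\lambda\oplus J_\infty\oplus A_M,$$ where $A_S,J_\lambda,J_\infty,A_M$ are the graph restrictions $A\cap(\mathfrak X\times\mathfrak X)$ of $A$ to the subspaces $\mathfrak X=\mathfrak R_c(A),\mathfrak X_\lambda,\mathfrak X_\infty,\mathfrak R_m$, and each of these parts is the span of the pairs of the chains of its type. Its chain structure is the list of the types and lengths of its chains. **Proposition.** Let $A$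 and $A'$ be linear relations in $H$ with the same Weyr characteristic. Then $\sigma_\pi(A)=\sigma_\pi(A')$, and $A$ and $A'$ have the same Jordan-like decomposition with respect to the same subspace decomposition, up to the choice of the chain vectors, in the following sense. 1. There are Jordan-like decompositions of $A$ and of $A'$ with one and the same chain structure, each with the following properties (stated for $A$). The $k$-th vectors of the singular chains, of the Jordan chains at $\lambda$ and of the Jordan chains at $\infty$ with at least $k$ vectors ($k\ge1$), and the $(k+1)$-st vectors of the shift chains with at least $k+1$ vectors ($k\ge0$), represent bases of the quotient spaces above whose dimensions are $B_k$, $W_k(\lambda)$, $A_k$ and $C_k$. Moreover $\mathfrak R_\lambda(A)=\mathfrak R_c(A)\oplus\mathfrak X_\lambda$ for $\lambda\in\mathbb C\cup\{\infty\}$, with $\mathfrak X_\lambda=\{0\}$ for $\lambda\notin\sigma_\pi(A)$. The part $A_S$ is completely singular, i.e. $A_S=A_S\cap(\mathfrak R_c(A_S)\times\mathfrak R_c(A_S))$. For $\lambda\in\sigma_\pi(A)\cap\mathbb C$ the part $J_\lambda$ is a Jordan operator in $\mathfrak X_\lambda$ corresponding to $\lambda$, i.e. $\operatorname{dom}J_\lambda=\mathfrak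 X_\lambda$, $\operatorname{mul}J_\lambda=\{0\}$, $\sigma_p(J_\lambda)=\{\lambda\}$. If $\infty\in\sigma_\pi(A)$, then $J_\infty^{-1}$ is a Jordan operator in $\mathfrak X_\infty$ corresponding to $0$. The part $A_M$ is a multishift, i.e. $\sigma_p(A_M)=\emptyset$. 2. Any Jordan-like decomposition of $A$ and any Jordan-like decomposition of $A'$ have the same chain structure: there are a bijection between their chains that preserves types and lengths, and an invertible linear map $T:H\to H$ that carries every chain of $A$, vector by vector, onto the corresponding chain of $A'$, carries each of the spaces $\mathfrak R_c(A),\mathfrak X_\lambda,\mathfrak X_\infty,\mathfrak R_m$ of $A$ onto the corresponding space of $A'$, and (through $T\times T$) each of the parts $A_S,J_\lambda,J_\infty,A_M$ of $A$ onto the corresponding part of $A'$. -/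

import Mathlib

/-- A linear relation in the complex linear space `H` is a subspace of `H × H`. -/
abbrev LinRel (H : Type*) [AddCommGroup H] [Module ℂ H] := Submodule ℂ (H × H)

namespace LinRel

section Basic

variable {H : Type*} [AddCommGroup H] [Module ℂ H]

/-- `dom A = {x | ∃ y, (x, y) ∈ A}`. -/
def dom (A : LinRel H) : Submodule ℂ H := Submodule.map (LinearMap.fst ℂ H H) A

/-- `ran A = {y | ∃ x, (x, y) ∈ A}`. -/
def ran (A : LinRel H) : Submodule ℂ H := Submodule.map (LinearMap.snd ℂ H H) A

/-- `ker A = {x | (x, 0) ∈ A}`. -/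
def ker (A : LinRel H) : Submodule ℂ H := Submodule.comap (LinearMap.inl ℂ H H) A

/-- `mul A = {y | (0, y) ∈ A}`. -/
def mul (A : LinRel H) : Submodule ℂ H := Submodule.comap (LinearMap.inr ℂ H H) A

/-- The inverse relation `{(y, x) | (x, y) ∈ A}`. -/
def inverse (A : LinRel H) : LinRel H :=
  Submodule.comap (LinearMap.prod (LinearMap.snd ℂ H H) (LinearMap.fst ℂ H H)) A

/-- `A - z = {(x, y - z x) | (x, y) ∈ A}`. -/
def subScalar (A : LinRel H) (z : ℂ) : LinRel H :=
  Submodule.map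
    (LinearMap.prod (LinearMap.fst ℂ H H) (LinearMap.snd ℂ H H - z • LinearMap.fst ℂ H H)) A

/-- The product `A B = {(x, z) | ∃ y, (x, y) ∈ B ∧ (y, z) ∈ A}`. -/
def comp (A B : LinRel H) : LinRel H where
  carrier := {p | ∃ y : H, (p.1, y) ∈ B ∧ (y, p.2) ∈ A}
  add_mem' := by
    rintro p q ⟨y, hy, hy'⟩ ⟨w, hw, hw'⟩
    exact ⟨y + w, B.add_mem hy hw, A.add_mem hy' hw'⟩
  zero_mem' := ⟨0, B.zero_mem, A.zero_mem⟩
  smul_mem' := by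
    rintro c p ⟨y, hy, hy'⟩
    exact ⟨c • y, B.smul_mem c hy, A.smul_mem c hy'⟩

/-- Powers of a linear relation; `A ^ 0` is the identity operator on `H`. -/
def power (A : LinRel H) : ℕ → LinRel H
  | 0 => LinearMap.graph LinearMap.id
  | n + 1 => comp A (power A n)

/-- The space `H(A) = dom A + ran A`. -/
def support (A : LinRel H) : Submodule ℂ H := dom A ⊔ ran A

/-- The graph restriction `A ∩ (X × X)`. -/
def restrict (A : LinRel H) (X : Submodule ℂ H) : LinRel H := A ⊓ X.prod X

/-- The root space at a finite point `z`, spanned by all `ker (A - z) ^ i`. -/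
def rootSpace (A : LinRel H) (z : ℂ) : Submodule ℂ H :=
  ⨆ i : ℕ, ker (power (subScalar A z) i)

/-- The root space at `∞`, spanned by all `mul A ^ i`. -/
def rootSpaceInfty (A : LinRel H) : Submodule ℂ H := ⨆ i : ℕ, mul (power A i)

/-- The total root space. -/
def totalRootSpace (A : LinRel H) : Submodule ℂ H := (⨆ z : ℂ, rootSpace A z) ⊔ rootSpaceInfty A

/-- The singular chain subspace. -/
def singularSpace (A : LinRel H) : Submodule ℂ H := rootSpace A 0 ⊓ rootSpaceInfty A

/-- The point spectrum, a subset of the extended complex plane. -/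
def pointSpectrum (A : LinRel H) : Set (OnePoint ℂ) :=
  {w | (∃ z : ℂ, w = (z : OnePoint ℂ) ∧ ker (subScalar A z) ≠ ⊥) ∨
    (w = OnePoint.infty ∧ mul A ≠ ⊥)}

/-- The proper point spectrum: those `w` in the point spectrum
whose root space is not contained in the singular chain subspace. -/
def properPointSpectrum (A : LinRel H) : Set (OnePoint ℂ) :=
  {w | w ∈ pointSpectrum A ∧
    ((∃ z : ℂ, w = (z : OnePoint ℂ) ∧
        ((rootSpace A z : Set H) \ (singularSpace A : Set H)).Nonempty) ∨
      (w = OnePoint.infty ∧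
        ((rootSpaceInfty A : Set H) \ (singularSpace A : Set H)).Nonempty))}

/-- `A` is completely singular if it equals its own graph restriction to its singular
chain subspace. -/
def IsCompletelySingular (A : LinRel H) : Prop := A = restrict A (singularSpace A)

/-- `J` is a Jordan operator in the subspace `X` corresponding to `z`. -/
def IsJordanOperator (J : LinRel H) (X : Submodule ℂ H) (z : ℂ) : Prop :=
  J ≤ X.prod X ∧ dom J = X ∧ mul J = ⊥ ∧ pointSpectrum J = {(z : OnePoint ℂ)}

/-- `J` is a Jordan relation in the subspace `X` (corresponding to `∞`). -/
def IsJordanRelation (J : LinRel H) (X : Submodule ℂ H) : Prop :=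
  IsJordanOperator (inverse J) X 0

/-- A multishift is a linear relation without eigenvalues in `ℂ ∪ {∞}`. -/
def IsMultishift (A : LinRel H) : Prop := pointSpectrum A = ∅

/-- The graph restrictions of `A` to the subspaces `X i` form a reducing sum decomposition of `A`:
the `X i` form a direct sum, and `A` is the direct sum of its graph restrictions to them.
(Members of the family that are zero do not matter.) -/
structure IsReducingSum {ι : Type*} (A : LinRel H) (X : ι → Submodule ℂ H) : Prop where
  spaces_independent : iSupIndep X
  parts_independent : iSupIndep (fun i => restrict A (X i))
  sum_eq : A = ⨆ i, restrict A (X i)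

end Basic

/-- The four types of parts of a linear relation: completely singular, Jordan at a finite point,
Jordan at `∞`, multishift. -/
inductive PartKind where
  | singular : PartKind
  | finite (z : ℂ) : PartKind
  | infinite : PartKind
  | shift : PartKind

section Weyr

variable {H : Type*} [AddCommGroup H] [Module ℂ H]

/-- Numerators of the four sequences of quotient spaces.  For the first three types the index `k`
stands for the `(k+1)`-st space of a sequence that is numbered from `1`; the sequence of the
shift type is numbered from `0`. -/
def quotNum (A : LinRel H) : PartKind → ℕ → Submodule ℂ H
  | .singular, k => ker (power A (k + 1)) ⊓ singularSpace A
  | .finite z, k => ker (power (subScalar A z) (k + 1)) ⊔ singularSpace A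
  | .infinite, k => mul (power A (k + 1)) ⊔ singularSpace A
  | .shift, 0 => dom A ⊔ ran A
  | .shift, k + 1 => ran (power A (k + 1)) ⊔ totalRootSpace A

/-- Denominators of the four sequences of quotient spaces, numbered as the numerators.
For `k = 0` the kernel and the multivalued part of the zeroth power (the identity) vanish, so
that the denominators of the first three types are `0`, the singular chain subspace, and the
singular chain subspace. -/
def quotDen (A : LinRel H) : PartKind → ℕ → Submodule ℂ H
  | .singular, k => ker (power A k) ⊓ singularSpace A
  | .finite z, k => ker (power (subScalar A z) k) ⊔ singularSpace A
  | .infinite, k => mul (power A k) ⊔ singularSpace A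
  | .shift, k => ran (power A (k + 1)) ⊔ totalRootSpace A

/-- The quotient `N / D` (used for `D ≤ N`). -/
abbrev RelQuot (N D : Submodule ℂ H) := N ⧸ D.submoduleOf N

/-- The dimension of the `k`-th quotient space of the given type. -/
noncomputable def quotDim (A : LinRel H) (κ : PartKind) (k : ℕ) : ℕ :=
  Module.finrank ℂ (RelQuot (quotNum A κ k) (quotDen A κ k))

/-- The Weyr characteristic `(B, W, A, C)`.  The sequences `W(z)` are recorded together with
the points `z` they belong to. -/
@[ext] structure WeyrData where
  /-- `B k` is the entry `B_{k+1}`. -/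
  B : ℕ → ℕ
  /-- `W z k` is the entry `W_{k+1}(z)`. -/
  W : ℂ → ℕ → ℕ
  /-- `A k` is the entry `A_{k+1}`. -/
  A : ℕ → ℕ
  /-- `C k` is the entry `C_k`. -/
  C : ℕ → ℕ

/-- The Weyr characteristic of a linear relation.  `W(z)` is the null sequence
if `z` is not a proper eigenvalue, see `weyr_W_eq_zero`. -/
noncomputable def weyr (A : LinRel H) : WeyrData where
  B := quotDim A .singular
  W := fun z => quotDim A (.finite z)
  A := quotDim A .infinite
  C := quotDim A .shift

theorem ker_power_eq_bot (A : LinRel H) (h : ker A = ⊥) (k : ℕ) : ker (power A k) = ⊥ := by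
  induction k with
  | zero =>
    rw [eq_bot_iff]
    intro x hx
    have hx' : (0 : H) = x := hx
    simp [← hx']
  | succ k ih =>
    rw [eq_bot_iff]
    rintro x ⟨y, hy, hy'⟩
    have h1 : y ∈ ker A := hy'
    rw [h, Submodule.mem_bot] at h1
    subst h1
    have h2 : x ∈ ker (power A k) := hy
    rwa [ih] at h2

theorem weyr_W_eq_zero (A : LinRel H) (z : ℂ) (hz : (z : OnePoint ℂ) ∉ properPointSpectrum A) :
    (weyr A).W z = 0 := by
  have key : ∀ k, ker (power (subScalar A z) k) ≤ singularSpace A := by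
    intro k
    by_cases h : ker (subScalar A z) = ⊥
    · rw [ker_power_eq_bot _ h]; exact bot_le
    · by_contra hk
      obtain ⟨x, hx, hx'⟩ := SetLike.not_le_iff_exists.mp hk
      exact hz ⟨Or.inl ⟨z, rfl, h⟩, Or.inl ⟨z, rfl, x,
        (le_iSup (fun i => ker (power (subScalar A z) i)) k) hx, hx'⟩⟩
  funext k
  have h : quotDen A (.finite z) k = quotNum A (.finite z) k := by
    simp only [quotDen, quotNum]
    rw [sup_eq_right.mpr (key k), sup_eq_right.mpr (key (k + 1))]
  change quotDim A (.finite z) k = 0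
  unfold quotDim
  rw [h]
  have : Subsingleton (RelQuot (quotNum A (.finite z) k) (quotNum A (.finite z) k)) := by
    rw [Submodule.Quotient.subsingleton_iff, Submodule.submoduleOf_self]
  exact Module.finrank_zero_of_subsingleton

/-- The vectors `v i` lie in `N` and their classes form a basis of `N / D`. -/
def ClassesFormBasis {ι : Type*} (N D : Submodule ℂ H) (v : ι → H) : Prop :=
  ∃ h : ∀ i, v i ∈ N,
    LinearIndependent ℂ (fun i => (D.submoduleOf N).mkQ ⟨v i, h i⟩) ∧
    Submodule.span ℂ (Set.range fun i => (D.submoduleOf N).mkQ ⟨v i, h i⟩) = ⊤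

end Weyr

/-- A chain structure: finitely many chains, each with its type and
its (positive) number of vectors. -/
structure ChainShape where
  /-- the number of chains -/
  num : ℕ
  /-- the type of a chain -/
  kind : Fin num → PartKind
  /-- the number of vectors in a chain -/
  len : Fin num → ℕ
  len_pos : ∀ j, 0 < len j

/-- Index set for all the vectors in all the chains. -/
abbrev ChainShape.Index (s : ChainShape) := Σ j : Fin s.num, Fin (s.len j)

section Chains

variable {H : Type*} [AddCommGroup H] [Module ℂ H]

/-- The entry `x_k` (`1 ≤ k ≤ n`) of the `j`-th chain `x_1, …, x_n`; for all other `k`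
it is `0`. -/
def entry (s : ChainShape) (x : s.Index → H) (j : Fin s.num) (k : ℕ) : H :=
  if h : 1 ≤ k ∧ k ≤ s.len j then x ⟨j, ⟨k - 1, by omega⟩⟩ else 0

/-- The pairs of a chain of the given type with `n` entries `e 1, …, e n`
(and `e 0 = e (n + 1) = 0`):
* singular chain: `(0, e n), (e n, e (n-1)), …, (e 2, e 1), (e 1, 0)`;
* Jordan chain at `z`: `(e n, e (n-1) + z e n), …, (e 2, e 1 + z e 2), (e 1, z e 1)`;
* Jordan chain at `∞`: `(0, e 1), (e 1, e 2), …, (e (n-1), e n)`;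
* shift chain: `(e 1, e 2), …, (e (n-1), e n)`. -/
def chainPairs (n : ℕ) (e : ℕ → H) : PartKind → Set (H × H)
  | .singular => {p | ∃ k, k ≤ n ∧ p = (e (k + 1), e k)}
  | .finite z => {p | ∃ k, k < n ∧ p = (e (k + 1), e k + z • e (k + 1))}
  | .infinite => {p | ∃ k, k < n ∧ p = (e k, e (k + 1))}
  | .shift => {p | ∃ k, 1 ≤ k ∧ k < n ∧ p = (e k, e (k + 1))}

/-- The span of the vectors in all chains of the given type. -/
def chainSpace (s : ChainShape) (x : s.Index → H) (κ : PartKind) : Submodule ℂ H :=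
  Submodule.span ℂ {v | ∃ i : s.Index, s.kind i.1 = κ ∧ v = x i}

/-- The span of the pairs in all chains of the given type. -/
def chainRel (s : ChainShape) (x : s.Index → H) (κ : PartKind) : LinRel H :=
  Submodule.span ℂ {p | ∃ j, s.kind j = κ ∧ p ∈ chainPairs (s.len j) (entry s x j) κ}

/-- The chains `x` of shape `s` give a Jordan-like decomposition of `A`: a reducing sum
decomposition of `A` with respect to a direct sum decomposition of `dom A + ran A`, in which
the singular chain subspace is spanned by the entries of the singular chains, each other
space is spanned by the entries of the chains of its type, all entries are linearly
independent, and each part of `A` is spanned by the pairs of the chains of its type. -/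
structure IsJordanLike (A : LinRel H) (s : ChainShape) (x : s.Index → H) : Prop where
  independent : LinearIndependent ℂ x
  singular_eq : chainSpace s x .singular = singularSpace A
  support_eq : ⨆ κ, chainSpace s x κ = support A
  reducing : IsReducingSum A (chainSpace s x)
  part_eq : ∀ κ, restrict A (chainSpace s x κ) = chainRel s x κ

/-- A Jordan-like decomposition whose chains are built along the sequences of quotient spaces,
together with the properties of its parts. -/
structure IsWeyrJordanLike (A : LinRel H) (s : ChainShape) (x : s.Index → H) : Prop
    extends IsJordanLike A s x where
  /-- The `k`-th entries (counted from `0`) of the chains of a given type represent a basis of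
  the `k`-th quotient space of that type. -/
  classes_basis : ∀ (κ : PartKind) (k : ℕ),
    ClassesFormBasis (quotNum A κ k) (quotDen A κ k)
      (fun j : {j : Fin s.num // s.kind j = κ ∧ k < s.len j} => x ⟨j.1, ⟨k, j.2.2⟩⟩)
  rootSpace_eq : ∀ z : ℂ, rootSpace A z = singularSpace A ⊔ chainSpace s x (.finite z)
  rootSpaceInfty_eq : rootSpaceInfty A = singularSpace A ⊔ chainSpace s x .infinite
  /-- The completely singular part. -/
  singular_part : IsCompletelySingular (restrict A (chainSpace s x .singular))
  /-- The Jordan part at a finite proper eigenvalue. -/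
  finite_part : ∀ z : ℂ, (z : OnePoint ℂ) ∈ properPointSpectrum A →
    IsJordanOperator (restrict A (chainSpace s x (.finite z))) (chainSpace s x (.finite z)) z
  /-- There are no other finite Jordan parts. -/
  finite_absent : ∀ z : ℂ, (z : OnePoint ℂ) ∉ properPointSpectrum A →
    chainSpace s x (.finite z) = ⊥
  /-- The Jordan part at `∞`. -/
  infinite_part : OnePoint.infty ∈ properPointSpectrum A →
    IsJordanRelation (restrict A (chainSpace s x .infinite)) (chainSpace s x .infinite)
  infinite_absent : OnePoint.infty ∉ properPointSpectrum A → chainSpace s x .infinite = ⊥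
  /-- The multishift part. -/
  shift_part : IsMultishift (restrict A (chainSpace s x .shift))

end Chains

end LinRel

/-!
The proposition rests on two facts about a linear relation `A` in a finite-dimensional space.

*Existence* (`LinRel.exists_isChainDecomp`).  There are linearly independent chains whose pairs
span `A` and whose vectors span `dom A + ran A`.  All chain types are strings
`e 0 → e 1 → ⋯ → e (n - 1)` with or without an arrow `0 → e 0` on the left and an arrow
`e (n - 1) → 0` on the right, except that Jordan chains at nonzero points are first collected in one
part on which `A` is the graph of an automorphism.  Such a string decomposition exists by induction
on the dimension (`LinRel.exists_stringDecomp`).  If `ker A ≠ 0`, decompose the relation induced on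
`V ⧸ ker A`: a pair there lifts to a pair of `A` with any prescribed lift of its first component, so
strings lift from left to right, and those ending in `0` gain one vector of `ker A`.  If
`dom A ≠ V`, decompose the restriction of `A` to `dom A`: the last vector of a string without an
arrow on the right has an image under `A`, which prolongs the string.  In both steps the new vectors
are independent because their preimages are, and what is missing is added as strings of length one.
If `ker A = 0` and `dom A = V`, then `A` is the graph of an automorphism.  Applied to the graph of
`f - z` with an eigenvalue `z` of `f`, the same theorem splits off the Jordan chains of `f` at `z`,
which gives Jordan bases (`LinRel.exists_jordan_basis`) and so the chains of the bijective part.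

*Rigidity* (`LinRel.IsChainDecomp.isWeyrJordanLike`, `LinRel.IsChainDecomp.quotDim_eq`).  Membership
in `A` forces simple relations between coordinates with respect to the chain vectors.  Hence the
root spaces and all the numerators and denominators of the quotient spaces are spanned by subsets of
the chain vectors, and the dimension of the `k`-th quotient of a type is the number of chains of
that type with more than `k` vectors.  The only computation that is not a matter of shifting indices
is that every finite root space contains the singular chains
(`LinRel.mem_rootSpace_of_singular_chain`).

Consequently the Weyr characteristic determines the numbers of chains of every type and length, thus
the chains of `A` and `A'` up to renumbering; a linear automorphism that carries the independent
chain vectors of `A` to those of `A'` then carries everything else along.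
-/

namespace LinRel

/-! ### Membership in powers and translates -/

section Powers

variable {H : Type*} [AddCommGroup H] [Module ℂ H]

theorem mem_ker {A : LinRel H} {u : H} : u ∈ ker A ↔ (u, (0 : H)) ∈ A := Iff.rfl

theorem mem_mul {A : LinRel H} {v : H} : v ∈ mul A ↔ ((0 : H), v) ∈ A := Iff.rfl

theorem mem_dom {A : LinRel H} {u : H} : u ∈ dom A ↔ ∃ v, (u, v) ∈ A := by
  simp [dom, Submodule.mem_map]

theorem mem_ran {A : LinRel H} {v : H} : v ∈ ran A ↔ ∃ u, (u, v) ∈ A := by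
  simp [ran, Submodule.mem_map]

theorem mem_subScalar {A : LinRel H} {z : ℂ} {u w : H} :
    (u, w) ∈ subScalar A z ↔ (u, w + z • u) ∈ A := by
  constructor
  · rintro ⟨⟨a, b⟩, hab, h⟩
    obtain ⟨rfl, rfl⟩ := Prod.mk.inj h
    simpa using hab
  · intro h
    exact ⟨_, h, by simp⟩

theorem subScalar_zero (A : LinRel H) : subScalar A 0 = A := by
  ext ⟨u, w⟩
  simp [mem_subScalar]

theorem mem_restrict {A : LinRel H} {X : Submodule ℂ H} {u v : H} :
    (u, v) ∈ restrict A X ↔ (u, v) ∈ A ∧ u ∈ X ∧ v ∈ X := by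
  simp [restrict, Submodule.mem_inf, Submodule.mem_prod]

theorem power_succ' (A : LinRel H) (k : ℕ) : power A (k + 1) = comp (power A k) A := by
  induction k with
  | zero =>
    ext ⟨u, v⟩
    constructor
    · rintro ⟨y, hy, hy'⟩
      have hy : u = y := hy.symm
      subst hy
      exact ⟨v, hy', rfl⟩
    · rintro ⟨y, hy, hy'⟩
      have hy' : v = y := hy'
      subst hy'
      exact ⟨u, rfl, hy⟩
  | succ k ih =>
    ext ⟨u, v⟩
    constructor
    · rintro ⟨y, hy, hy'⟩
      rw [ih] at hy
      obtain ⟨w, hw, hw'⟩ := hy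
      exact ⟨w, hw, y, hw', hy'⟩
    · rintro ⟨w, hw, y, hw', hy'⟩
      refine ⟨y, ?_, hy'⟩
      rw [ih]
      exact ⟨w, hw, hw'⟩

theorem mem_ker_power_zero {A : LinRel H} {u : H} : u ∈ ker (power A 0) ↔ u = 0 :=
  ⟨fun h => (show (0 : H) = u from h).symm, fun h => (show (0 : H) = u from h.symm)⟩

theorem mem_mul_power_zero {A : LinRel H} {v : H} : v ∈ mul (power A 0) ↔ v = 0 :=
  ⟨fun h => h, fun h => h⟩

theorem mem_ker_power_succ {A : LinRel H} {k : ℕ} {u : H} :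
    u ∈ ker (power A (k + 1)) ↔ ∃ w, (u, w) ∈ A ∧ w ∈ ker (power A k) := by
  rw [power_succ']; rfl

theorem mem_mul_power_succ {A : LinRel H} {k : ℕ} {v : H} :
    v ∈ mul (power A (k + 1)) ↔ ∃ w, w ∈ mul (power A k) ∧ (w, v) ∈ A := Iff.rfl

theorem mem_ran_power_succ {A : LinRel H} {k : ℕ} {v : H} :
    v ∈ ran (power A (k + 1)) ↔ ∃ w, w ∈ ran (power A k) ∧ (w, v) ∈ A := by
  constructor
  · intro h
    obtain ⟨u, w, hw, hw'⟩ := mem_ran.1 h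
    exact ⟨w, mem_ran.2 ⟨u, hw⟩, hw'⟩
  · rintro ⟨w, hw, hw'⟩
    obtain ⟨u, hu⟩ := mem_ran.1 hw
    exact mem_ran.2 ⟨u, w, hu, hw'⟩

theorem mem_ran_power_zero {A : LinRel H} (v : H) : v ∈ ran (power A 0) := mem_ran.2 ⟨v, rfl⟩

theorem mem_ker_power_of_chain {B : LinRel H} {e : ℕ → H} {n : ℕ} (h0 : e 0 = 0)
    (h : ∀ k < n, (e (k + 1), e k) ∈ B) : ∀ k l, l ≤ k → l ≤ n → e l ∈ ker (power B k) := by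
  intro k
  induction k with
  | zero =>
    intro l hl _
    obtain rfl : l = 0 := by omega
    exact mem_ker_power_zero.2 h0
  | succ k ih =>
    rintro (_ | l) hl hn
    · rw [h0]; exact Submodule.zero_mem _
    · exact mem_ker_power_succ.2 ⟨e l, h l (by omega), ih l (by omega) (by omega)⟩

theorem mem_mul_power_of_chain {B : LinRel H} {e : ℕ → H} {n : ℕ} (h0 : e 0 = 0)
    (h : ∀ k < n, (e k, e (k + 1)) ∈ B) : ∀ k l, l ≤ k → l ≤ n → e l ∈ mul (power B k) := by
  intro k
  induction k with
  | zero =>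
    intro l hl _
    obtain rfl : l = 0 := by omega
    exact mem_mul_power_zero.2 h0
  | succ k ih =>
    rintro (_ | l) hl hn
    · rw [h0]; exact Submodule.zero_mem _
    · exact mem_mul_power_succ.2 ⟨e l, ih l (by omega) (by omega), h l (by omega)⟩

theorem mem_ran_power_of_chain {B : LinRel H} {e : ℕ → H} {n : ℕ}
    (h : ∀ k, 1 ≤ k → k < n → (e k, e (k + 1)) ∈ B) :
    ∀ k l, k < l → l ≤ n → e l ∈ ran (power B k) := by
  intro k
  induction k with
  | zero => exact fun l _ _ => mem_ran_power_zero _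
  | succ k ih =>
    rintro (_ | l) hl hn
    · omega
    · exact mem_ran_power_succ.2 ⟨e l, ih l (by omega) (by omega), h l (by omega) (by omega)⟩

/-- The vectors of a singular chain lie in every finite root space.  For a singular chain
`e 1, …, e n` the vectors `f m = ∑ k, (k choose m) z ^ (k - m) e (k + 1)` form a singular chain of
`A - z`, and `f m` is `e (m + 1)` up to a combination of later vectors. -/
theorem mem_rootSpace_of_singular_chain {B : LinRel H} {e : ℕ → H} {n : ℕ} (h0 : e 0 = 0)
    (hn : ∀ k, n < k → e k = 0) (h : ∀ k ≤ n, (e (k + 1), e k) ∈ B) (z : ℂ) (k : ℕ) :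
    e k ∈ rootSpace B z := by
  let f : ℕ → H := fun m => ∑ k ∈ Finset.range (n + 1), ((k.choose m : ℂ) * z ^ (k - m)) • e (k + 1)
  -- Combine the pairs of the chain and shift the index in the second component.
  have hshift : ∀ c : ℕ → ℂ, (∑ k ∈ Finset.range (n + 1), c k • e (k + 1),
      ∑ k ∈ Finset.range (n + 1), c (k + 1) • e (k + 1)) ∈ B := by
    intro c
    have h1 : ∑ k ∈ Finset.range (n + 1), c k • ((e (k + 1), e k) : H × H) ∈ B :=
      Submodule.sum_mem _ fun k hk => B.smul_mem _ (h k (by simpa [Nat.lt_succ_iff] using hk))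
    have h2 : ∑ k ∈ Finset.range (n + 1), c k • ((e (k + 1), e k) : H × H)
        = (∑ k ∈ Finset.range (n + 1), c k • e (k + 1), ∑ k ∈ Finset.range (n + 1), c k • e k) := by
      ext <;> simp [Prod.fst_sum, Prod.snd_sum]
    have h3 : ∑ k ∈ Finset.range (n + 1), c k • e k
        = ∑ k ∈ Finset.range (n + 1), c (k + 1) • e (k + 1) := by
      rw [Finset.sum_range_succ', Finset.sum_range_succ (fun k => c (k + 1) • e (k + 1)),
        h0, hn (n + 1) (by omega)]
      simp
    rw [← h3, ← h2]; exact h1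
  have hf0 : (f 0, (0 : H)) ∈ subScalar B z := by
    rw [mem_subScalar]
    convert hshift (fun k => z ^ k) using 2
    · simp [f]
    · simp only [f, zero_add, Finset.smul_sum, smul_smul]
      refine Finset.sum_congr rfl fun k _ => ?_
      congr 1
      simp [pow_succ, mul_comm]
  have hf : ∀ m, (f (m + 1), f m) ∈ subScalar B z := by
    intro m
    rw [mem_subScalar]
    convert hshift (fun k => (k.choose (m + 1) : ℂ) * z ^ (k - (m + 1))) using 2
    simp only [f, Finset.smul_sum, smul_smul]
    rw [← Finset.sum_add_distrib]
    refine Finset.sum_congr rfl fun k _ => ?_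
    rw [← add_smul]
    congr 1
    rw [Nat.choose_succ_succ, Nat.add_sub_add_right]
    push_cast
    rcases lt_or_ge k (m + 1) with hk | hk
    · simp [Nat.choose_eq_zero_of_lt hk]
    · obtain ⟨d, rfl⟩ := Nat.exists_eq_add_of_le hk
      have h1 : m + 1 + d - m = d + 1 := by omega
      have h2 : m + 1 + d - (m + 1) = d := by omega
      rw [h1, h2]; ring
  have hfR : ∀ m, f m ∈ rootSpace B z := by
    intro m
    have : ∀ m, f m ∈ ker (power (subScalar B z) (m + 1)) := by
      intro m
      induction m with
      | zero => exact mem_ker_power_succ.2 ⟨0, hf0, mem_ker_power_zero.2 rfl⟩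
      | succ m ih => exact mem_ker_power_succ.2 ⟨f m, hf m, ih⟩
    exact (le_iSup (fun i => ker (power (subScalar B z) i)) (m + 1)) (this m)
  -- Downward induction on `m`: `f m` is `e (m + 1)` plus a combination of later vectors.
  have key : ∀ d m, n ≤ m + d → e (m + 1) ∈ rootSpace B z := by
    intro d
    induction d with
    | zero => intro m hm; rw [hn _ (by omega)]; exact Submodule.zero_mem _
    | succ d ih =>
      intro m hm
      by_cases hmn : m ≤ n
      · have h1 : f m = e (m + 1) + ∑ k ∈ (Finset.range (n + 1)).erase m,
            ((k.choose m : ℂ) * z ^ (k - m)) • e (k + 1) := by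
          change ∑ k ∈ Finset.range (n + 1), ((k.choose m : ℂ) * z ^ (k - m)) • e (k + 1) = _
          rw [← Finset.add_sum_erase _ _ (show m ∈ Finset.range (n + 1) by simp; omega)]
          simp
        have h2 : ∑ k ∈ (Finset.range (n + 1)).erase m,
            ((k.choose m : ℂ) * z ^ (k - m)) • e (k + 1) ∈ rootSpace B z := by
          refine Submodule.sum_mem _ fun k hk => ?_
          rcases lt_or_ge k m with hkm | hkm
          · simp [Nat.choose_eq_zero_of_lt hkm]
          · have : k ≠ m := (Finset.mem_erase.1 hk).1
            exact Submodule.smul_mem _ _ (ih k (by omega))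
        rw [eq_sub_of_add_eq h1.symm]
        exact Submodule.sub_mem _ (hfR m) h2
      · rw [hn _ (by omega)]; exact Submodule.zero_mem _
  rcases k with _ | k
  · rw [h0]; exact Submodule.zero_mem _
  · exact key n k (by omega)

end Powers

/-! ### Coordinates with respect to a system of chains -/

section Entry

variable {H : Type*} [AddCommGroup H] {s : ChainShape} {x : s.Index → H}

theorem entry_zero (j : Fin s.num) : entry s x j 0 = 0 := by simp [entry]

theorem entry_eq_zero_of_lt {j : Fin s.num} {k : ℕ} (hk : s.len j < k) : entry s x j k = 0 := by
  rw [entry, dif_neg (by omega)]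

theorem entry_succ (i : s.Index) : entry s x i.1 (i.2 + 1) = x i := by
  rw [entry, dif_pos ⟨by omega, i.2.2⟩]
  rfl

end Entry

section Coordinates

variable {H : Type*} [AddCommGroup H] [Module ℂ H]

/-- The chains `x` of shape `s` are linearly independent, their entries span `dom A + ran A` and
their pairs span `A`.  Every other property of a Jordan-like decomposition follows from these
three. -/
structure IsChainDecomp (A : LinRel H) (s : ChainShape) (x : s.Index → H) : Prop where
  independent : LinearIndependent ℂ x
  support_eq : ⨆ κ, chainSpace s x κ = support A
  rel_eq : A = ⨆ κ, chainRel s x κ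

theorem IsJordanLike.isChainDecomp {A : LinRel H} {s : ChainShape} {x : s.Index → H}
    (h : IsJordanLike A s x) : IsChainDecomp A s x where
  independent := h.independent
  support_eq := h.support_eq
  rel_eq := h.reducing.sum_eq.trans (iSup_congr h.part_eq)

variable {s : ChainShape} {x : s.Index → H}

theorem exists_dual (hx : LinearIndependent ℂ x) :
    ∃ φ : H →ₗ[ℂ] (s.Index →₀ ℂ), ∀ i, φ (x i) = Finsupp.single i 1 := by
  obtain ⟨φ, hφ⟩ := LinearMap.exists_leftInverse_of_injective
    (Finsupp.linearCombination ℂ x) (LinearMap.ker_eq_bot.2 hx)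
  refine ⟨φ, fun i => ?_⟩
  have := LinearMap.congr_fun hφ (Finsupp.single i 1)
  simpa using this

/-- The coefficient of the entry `k` (counted from `1`) of the chain `j`, extended linearly from
the span of the chains to the whole space; it is `0` for all `k` outside `1, …, s.len j`. -/
noncomputable def coord (hx : LinearIndependent ℂ x) (j : Fin s.num) (k : ℕ) : H →ₗ[ℂ] ℂ :=
  if h : 1 ≤ k ∧ k ≤ s.len j then
    (Finsupp.lapply (⟨j, ⟨k - 1, by omega⟩⟩ : s.Index)).comp (exists_dual hx).choose
  else 0

theorem coord_zero_right (hx : LinearIndependent ℂ x) (j : Fin s.num) : coord hx j 0 = 0 := by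
  rw [coord, dif_neg (by omega)]

theorem coord_of_lt (hx : LinearIndependent ℂ x) {j : Fin s.num} {k : ℕ} (h : s.len j < k) :
    coord hx j k = 0 := by
  rw [coord, dif_neg (by omega)]

theorem coord_x (hx : LinearIndependent ℂ x) (i p : s.Index) :
    coord hx i.1 (i.2 + 1) (x p) = if i = p then 1 else 0 := by
  rw [coord, dif_pos ⟨by omega, i.2.2⟩]
  have h := (exists_dual hx).choose_spec p
  simp only [LinearMap.comp_apply, h, Finsupp.lapply_apply]
  rw [Finsupp.single_apply]
  exact if_congr ⟨fun h => h.symm, fun h => h.symm⟩ rfl rfl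

theorem coord_entry (hx : LinearIndependent ℂ x) (j j' : Fin s.num) (k l : ℕ) :
    coord hx j k (entry s x j' l) =
      if j = j' ∧ k = l ∧ 1 ≤ k ∧ k ≤ s.len j then 1 else 0 := by
  by_cases hk : 1 ≤ k ∧ k ≤ s.len j
  · by_cases hl : 1 ≤ l ∧ l ≤ s.len j'
    · have h := coord_x hx ⟨j, ⟨k - 1, by omega⟩⟩ ⟨j', ⟨l - 1, by omega⟩⟩
      have hk1 : k - 1 + 1 = k := by omega
      rw [entry, dif_pos hl]
      simp only [hk1] at h
      rw [h]
      refine if_congr ?_ rfl rfl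
      constructor
      · intro h
        obtain ⟨rfl, h⟩ := Sigma.mk.inj h
        have := congrArg Fin.val (eq_of_heq h)
        simp only at this
        exact ⟨rfl, by omega, hk⟩
      · rintro ⟨rfl, rfl, _⟩
        rfl
    · rw [entry, dif_neg hl, map_zero, if_neg]
      rintro ⟨rfl, rfl, h⟩
      exact hl h
  · rw [coord, dif_neg hk, if_neg (fun h => hk h.2.2)]
    rfl

/-- The span of the entries whose position, a chain and a number counted from `1`, satisfies `P`.
Positions outside the chain contribute only zero vectors. -/
def posSpan (s : ChainShape) (x : s.Index → H) (P : Fin s.num → ℕ → Prop) : Submodule ℂ H :=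
  Submodule.span ℂ {v | ∃ j k, P j k ∧ v = entry s x j k}

theorem entry_mem_posSpan {P : Fin s.num → ℕ → Prop} {j : Fin s.num} {k : ℕ} (h : P j k) :
    entry s x j k ∈ posSpan s x P := Submodule.subset_span ⟨j, k, h, rfl⟩

theorem posSpan_le {P : Fin s.num → ℕ → Prop} {N : Submodule ℂ H}
    (h : ∀ j k, P j k → 1 ≤ k → k ≤ s.len j → entry s x j k ∈ N) : posSpan s x P ≤ N := by
  refine Submodule.span_le.2 ?_
  rintro _ ⟨j, k, hP, rfl⟩
  by_cases hk : 1 ≤ k ∧ k ≤ s.len j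
  · exact h j k hP hk.1 hk.2
  · rw [entry, dif_neg hk]; exact N.zero_mem

theorem posSpan_mono {P Q : Fin s.num → ℕ → Prop} (h : ∀ j k, P j k → Q j k) :
    posSpan s x P ≤ posSpan s x Q := posSpan_le fun j k hP _ _ => entry_mem_posSpan (h j k hP)

theorem posSpan_sup (P Q : Fin s.num → ℕ → Prop) :
    posSpan s x P ⊔ posSpan s x Q = posSpan s x (fun j k => P j k ∨ Q j k) := by
  refine le_antisymm (sup_le (posSpan_mono fun _ _ h => Or.inl h)
    (posSpan_mono fun _ _ h => Or.inr h)) (posSpan_le ?_)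
  rintro j k (h | h) _ _
  · exact Submodule.mem_sup_left (entry_mem_posSpan h)
  · exact Submodule.mem_sup_right (entry_mem_posSpan h)

theorem chainSpace_eq_posSpan (κ : PartKind) :
    chainSpace s x κ = posSpan s x (fun j _ => s.kind j = κ) := by
  refine le_antisymm (Submodule.span_le.2 ?_) (posSpan_le ?_)
  · rintro _ ⟨i, hi, rfl⟩
    rw [← entry_succ (x := x) i]
    exact entry_mem_posSpan (P := fun j _ => s.kind j = κ) hi
  · intro j k hj h1 h2
    rw [entry, dif_pos ⟨h1, h2⟩]
    exact Submodule.subset_span ⟨_, hj, rfl⟩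

theorem iSup_chainSpace : ⨆ κ, chainSpace s x κ = posSpan s x (fun _ _ => True) := by
  refine le_antisymm (iSup_le fun κ => ?_) (posSpan_le fun j k _ _ _ => ?_)
  · rw [chainSpace_eq_posSpan]; exact posSpan_mono fun _ _ _ => trivial
  · refine Submodule.mem_iSup_of_mem (s.kind j) ?_
    rw [chainSpace_eq_posSpan]
    exact entry_mem_posSpan (P := fun i _ => s.kind i = s.kind j) rfl

theorem coord_eq_zero_of_mem_posSpan (hx : LinearIndependent ℂ x) {P : Fin s.num → ℕ → Prop}
    {u : H} (hu : u ∈ posSpan s x P) {j : Fin s.num} {k : ℕ} (h : ¬ P j k) :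
    coord hx j k u = 0 := by
  have : posSpan s x P ≤ LinearMap.ker (coord hx j k) := by
    refine posSpan_le fun j' k' hP _ _ => ?_
    rw [LinearMap.mem_ker, coord_entry, if_neg]
    rintro ⟨rfl, rfl, _⟩
    exact h hP
  exact this hu

theorem eq_sum_coord (hx : LinearIndependent ℂ x) {u : H}
    (hu : u ∈ posSpan s x (fun _ _ => True)) :
    u = ∑ i : s.Index, coord hx i.1 (i.2 + 1) u • x i := by
  have : posSpan s x (fun _ _ => True) ≤ LinearMap.eqLocus LinearMap.id
      (∑ i : s.Index, (coord hx i.1 (i.2 + 1)).smulRight (x i)) := by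
    refine posSpan_le fun j k _ h1 h2 => ?_
    rw [LinearMap.mem_eqLocus, entry, dif_pos ⟨h1, h2⟩]
    simp [coord_x]
  have h := this hu
  rw [LinearMap.mem_eqLocus] at h
  simpa using h

theorem mem_posSpan_of_coord (hx : LinearIndependent ℂ x) {P : Fin s.num → ℕ → Prop} {u : H}
    (hu : u ∈ posSpan s x (fun _ _ => True)) (h : ∀ j k, ¬ P j k → coord hx j k u = 0) :
    u ∈ posSpan s x P := by
  rw [eq_sum_coord hx hu]
  refine Submodule.sum_mem _ fun i _ => ?_
  by_cases hi : P i.1 (i.2 + 1)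
  · refine Submodule.smul_mem _ _ ?_
    rw [← entry_succ (x := x) i]
    exact entry_mem_posSpan hi
  · rw [h _ _ hi, zero_smul]; exact Submodule.zero_mem _

theorem posSpan_inf (hx : LinearIndependent ℂ x) (P Q : Fin s.num → ℕ → Prop) :
    posSpan s x P ⊓ posSpan s x Q = posSpan s x (fun j k => P j k ∧ Q j k) := by
  refine le_antisymm ?_ (le_inf (posSpan_mono fun _ _ h => h.1) (posSpan_mono fun _ _ h => h.2))
  rintro u ⟨hP, hQ⟩
  refine mem_posSpan_of_coord hx (posSpan_mono (fun _ _ _ => trivial) hP) fun j k h => ?_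
  by_cases h' : P j k
  · exact coord_eq_zero_of_mem_posSpan hx hQ fun hQ' => h ⟨h', hQ'⟩
  · exact coord_eq_zero_of_mem_posSpan hx hP h'

/-- If `P` and `Q` hold on nested sets of positions, the entries in the difference represent a
basis of the quotient of the two spans. -/
theorem classesFormBasis_posSpan (hx : LinearIndependent ℂ x) {P Q : Fin s.num → ℕ → Prop}
    {ι : Type*} (y : ι → s.Index) (hy : Function.Injective y)
    (hPQ : ∀ p : s.Index, P p.1 (p.2 + 1) → ¬ Q p.1 (p.2 + 1) → ∃ i, y i = p)
    (hP : ∀ i, P (y i).1 ((y i).2 + 1)) (hQ : ∀ i, ¬ Q (y i).1 ((y i).2 + 1)) :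
    ClassesFormBasis (posSpan s x P) (posSpan s x Q) (fun i => x (y i)) := by
  have hmem : ∀ i, x (y i) ∈ posSpan s x P := fun i => by
    rw [← entry_succ (x := x)]; exact entry_mem_posSpan (hP i)
  refine ⟨hmem, ?_, ?_⟩
  · rw [linearIndependent_iff']
    intro t c hc i hi
    have h1 : ∑ i ∈ t, c i • x (y i) ∈ posSpan s x Q := by
      have : ((posSpan s x Q).submoduleOf (posSpan s x P)).mkQ
          (∑ i ∈ t, c i • ⟨x (y i), hmem i⟩) = 0 := by
        simp only [map_sum, map_smul]; exact hc
      rw [Submodule.mkQ_apply, Submodule.Quotient.mk_eq_zero] at this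
      have h2 := Submodule.mem_comap.1 this
      simpa using h2
    have h2 := coord_eq_zero_of_mem_posSpan hx h1 (hQ i)
    rw [map_sum] at h2
    rw [Finset.sum_eq_single_of_mem i hi fun b _ hb => by
      rw [map_smul, coord_x, if_neg (fun h => hb (hy h).symm), smul_zero]] at h2
    rwa [map_smul, coord_x, if_pos rfl, smul_eq_mul, mul_one] at h2
  · rw [eq_top_iff, ← Submodule.range_mkQ, LinearMap.range_eq_map, Submodule.map_le_iff_le_comap]
    set S := Submodule.comap ((posSpan s x Q).submoduleOf (posSpan s x P)).mkQ
      (Submodule.span ℂ (Set.range fun i =>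
        ((posSpan s x Q).submoduleOf (posSpan s x P)).mkQ ⟨x (y i), hmem i⟩)) with hS
    have key : posSpan s x P ≤ Submodule.map (posSpan s x P).subtype S := by
      refine posSpan_le fun j k hjk h1 h2 => ?_
      refine ⟨⟨entry s x j k, entry_mem_posSpan hjk⟩, ?_, rfl⟩
      simp only [hS, SetLike.mem_coe, Submodule.mem_comap]
      by_cases hq : Q j k
      · have : ((posSpan s x Q).submoduleOf (posSpan s x P)).mkQ
            ⟨entry s x j k, entry_mem_posSpan hjk⟩ = 0 := by
          rw [Submodule.mkQ_apply, Submodule.Quotient.mk_eq_zero]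
          exact Submodule.mem_comap.2 (entry_mem_posSpan hq)
        rw [this]; exact Submodule.zero_mem _
      · have hk1 : k - 1 + 1 = k := by omega
        obtain ⟨i, hi⟩ := hPQ ⟨j, ⟨k - 1, by omega⟩⟩ (by simpa only [hk1] using hjk)
          (by simpa only [hk1] using hq)
        refine Submodule.subset_span ⟨i, ?_⟩
        have : x (y i) = entry s x j k := by
          rw [hi, entry, dif_pos ⟨h1, h2⟩]
        simp only [this]
    rintro ⟨u, hu⟩ -
    obtain ⟨⟨v, hv⟩, hvS, hvu⟩ := key hu
    obtain rfl : v = u := hvu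
    exact hvS

end Coordinates

/-! ### Root spaces, powers and ranges in coordinates -/

/-- A sequence that vanishes far out and satisfies `a k = c a (k + 1)` is zero. -/
theorem eq_zero_of_backward {a : ℕ → ℂ} {c : ℂ} {n : ℕ}
    (ha : ∀ k, 1 ≤ k → a k = c * a (k + 1)) (hn : ∀ k, n < k → a k = 0) {k : ℕ} (hk : 1 ≤ k) :
    a k = 0 := by
  have key : ∀ d k, 1 ≤ k → n < k + d → a k = 0 := by
    intro d
    induction d with
    | zero => exact fun k _ h => hn k h
    | succ d ih => intro k h1 h; rw [ha k h1, ih (k + 1) (by omega) (by omega), mul_zero]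
  exact key (n + 1) k hk (by omega)

section Computation

variable {H : Type*} [AddCommGroup H] [Module ℂ H]
  {A : LinRel H} {s : ChainShape} {x : s.Index → H}

theorem chainRel_le {κ : PartKind} {Q : LinRel H}
    (hQ : ∀ j, s.kind j = κ → ∀ p ∈ chainPairs (s.len j) (entry s x j) κ, p ∈ Q) :
    chainRel s x κ ≤ Q := by
  refine Submodule.span_le.2 ?_
  rintro p ⟨j, hj, hp⟩
  exact hQ j hj p hp

theorem mem_chainRel {κ : PartKind} {j : Fin s.num} (hj : s.kind j = κ) {p : H × H}
    (hp : p ∈ chainPairs (s.len j) (entry s x j) κ) : p ∈ chainRel s x κ :=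
  Submodule.subset_span ⟨j, hj, hp⟩

theorem chainRel_le_prod (κ : PartKind) :
    chainRel s x κ ≤ (chainSpace s x κ).prod (chainSpace s x κ) := by
  refine chainRel_le fun j hj p hp => ?_
  have he : ∀ k, entry s x j k ∈ chainSpace s x κ := fun k => by
    rw [chainSpace_eq_posSpan]; exact entry_mem_posSpan hj
  cases κ <;> rcases hp with ⟨k, hk⟩
  · rw [hk.2]; exact ⟨he _, he _⟩
  · rw [hk.2]; exact ⟨he _, Submodule.add_mem _ (he _) (Submodule.smul_mem _ _ (he _))⟩
  · rw [hk.2]; exact ⟨he _, he _⟩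
  · rw [hk.2.2]; exact ⟨he _, he _⟩

namespace IsChainDecomp

theorem rel_le (h : IsChainDecomp A s x) {Q : LinRel H} (hQ : ∀ κ, ∀ j, s.kind j = κ →
    ∀ p ∈ chainPairs (s.len j) (entry s x j) κ, p ∈ Q) : A ≤ Q := by
  rw [h.rel_eq]
  exact iSup_le fun κ => chainRel_le (hQ κ)

theorem support_eq_posSpan (h : IsChainDecomp A s x) :
    support A = posSpan s x (fun _ _ => True) := by
  rw [← h.support_eq, iSup_chainSpace]

theorem left_mem (h : IsChainDecomp A s x) {u v : H} (huv : (u, v) ∈ A) :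
    u ∈ posSpan s x (fun _ _ => True) := by
  rw [← h.support_eq_posSpan]
  exact Submodule.mem_sup_left (mem_dom.2 ⟨v, huv⟩)

theorem right_mem (h : IsChainDecomp A s x) {u v : H} (huv : (u, v) ∈ A) :
    v ∈ posSpan s x (fun _ _ => True) := by
  rw [← h.support_eq_posSpan]
  exact Submodule.mem_sup_right (mem_ran.2 ⟨u, huv⟩)

/-- A linear identity between coordinates of the two components holds on `A` if it holds on the
pairs of the chains. -/
theorem coord_identity (h : IsChainDecomp A s x) {f g : H →ₗ[ℂ] ℂ}
    (hfg : ∀ κ, ∀ j, s.kind j = κ →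
      ∀ p ∈ chainPairs (s.len j) (entry s x j) κ, f p.1 = g p.2)
    {u v : H} (huv : (u, v) ∈ A) : f u = g v := by
  have hle : A ≤ LinearMap.eqLocus (f.comp (LinearMap.fst ℂ H H))
      (g.comp (LinearMap.snd ℂ H H)) :=
    h.rel_le fun κ j hj p hp => by
      simpa [LinearMap.mem_eqLocus] using hfg κ j hj p hp
  simpa [LinearMap.mem_eqLocus] using hle huv

theorem coord_singular (h : IsChainDecomp A s x) {u v : H} (huv : (u, v) ∈ A) {j : Fin s.num}
    (hj : s.kind j = .singular) {k : ℕ} (h1 : 1 ≤ k) (h2 : k < s.len j) :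
    coord h.independent j (k + 1) u = coord h.independent j k v := by
  refine h.coord_identity (fun κ j' hj' p hp => ?_) huv
  by_cases hjj : j = j'
  · subst hjj
    rw [hj] at hj'
    subst hj'
    obtain ⟨l, hl, rfl⟩ := hp
    simp only [coord_entry, true_and]
    exact if_congr (by omega) rfl rfl
  · cases κ <;> rcases hp with ⟨l, hl⟩
    · rw [hl.2]; simp [coord_entry, hjj]
    · rw [hl.2]; simp [coord_entry, hjj]
    · rw [hl.2]; simp [coord_entry, hjj]
    · rw [hl.2.2]; simp [coord_entry, hjj]

theorem coord_finite (h : IsChainDecomp A s x) {u v : H} (huv : (u, v) ∈ A) {j : Fin s.num}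
    {z : ℂ} (hj : s.kind j = .finite z) {k : ℕ} (h1 : 1 ≤ k) :
    coord h.independent j (k + 1) u + z * coord h.independent j k u =
      coord h.independent j k v := by
  refine h.coord_identity
    (f := coord h.independent j (k + 1) + z • coord h.independent j k) (fun κ j' hj' p hp => ?_) huv
  by_cases hjj : j = j'
  · subst hjj
    rw [hj] at hj'
    subst hj'
    obtain ⟨l, hl, rfl⟩ := hp
    simp only [coord_entry, true_and, LinearMap.add_apply, LinearMap.smul_apply, map_add, map_smul]
    congr 1
    exact if_congr (by omega) rfl rfl
  · cases κ <;> rcases hp with ⟨l, hl⟩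
    · rw [hl.2]; simp [coord_entry, hjj]
    · rw [hl.2]; simp [coord_entry, hjj]
    · rw [hl.2]; simp [coord_entry, hjj]
    · rw [hl.2.2]; simp [coord_entry, hjj]

theorem coord_infinite (h : IsChainDecomp A s x) {u v : H} (huv : (u, v) ∈ A) {j : Fin s.num}
    (hj : s.kind j = .infinite) {k : ℕ} (h1 : 1 ≤ k) :
    coord h.independent j k u = coord h.independent j (k + 1) v := by
  refine h.coord_identity (fun κ j' hj' p hp => ?_) huv
  by_cases hjj : j = j'
  · subst hjj
    rw [hj] at hj'
    subst hj'
    obtain ⟨l, hl, rfl⟩ := hp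
    simp only [coord_entry, true_and]
    exact if_congr (by omega) rfl rfl
  · cases κ <;> rcases hp with ⟨l, hl⟩
    · rw [hl.2]; simp [coord_entry, hjj]
    · rw [hl.2]; simp [coord_entry, hjj]
    · rw [hl.2]; simp [coord_entry, hjj]
    · rw [hl.2.2]; simp [coord_entry, hjj]

theorem coord_shift (h : IsChainDecomp A s x) {u v : H} (huv : (u, v) ∈ A) {j : Fin s.num}
    (hj : s.kind j = .shift) (k : ℕ) :
    coord h.independent j k u = coord h.independent j (k + 1) v := by
  refine h.coord_identity (fun κ j' hj' p hp => ?_) huv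
  by_cases hjj : j = j'
  · subst hjj
    rw [hj] at hj'
    subst hj'
    obtain ⟨l, hl1, hl, rfl⟩ := hp
    simp only [coord_entry, true_and]
    exact if_congr (by omega) rfl rfl
  · cases κ <;> rcases hp with ⟨l, hl⟩
    · rw [hl.2]; simp [coord_entry, hjj]
    · rw [hl.2]; simp [coord_entry, hjj]
    · rw [hl.2]; simp [coord_entry, hjj]
    · rw [hl.2.2]; simp [coord_entry, hjj]

/-- The coordinates that may be nonzero on the kernel of `(A - z) ^ k`. -/
theorem ker_power_le (h : IsChainDecomp A s x) (z : ℂ) (k : ℕ) :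
    ker (power (subScalar A z) k) ≤ posSpan s x (fun j l =>
      (s.kind j = .singular ∧ (z = 0 → l ≤ k)) ∨ (s.kind j = .finite z ∧ l ≤ k)) := by
  induction k with
  | zero =>
    intro u hu
    rw [mem_ker_power_zero.1 hu]
    exact Submodule.zero_mem _
  | succ k ih =>
    intro u hu
    obtain ⟨w, huw, hw⟩ := mem_ker_power_succ.1 hu
    have hA := mem_subScalar.1 huw
    have hw0 := fun {j l} hl => coord_eq_zero_of_mem_posSpan h.independent (ih hw) (j := j) (k := l) hl
    refine mem_posSpan_of_coord h.independent (h.left_mem hA) fun j l hl => ?_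
    rcases Nat.eq_zero_or_pos l with rfl | hl0
    · rw [coord_zero_right]; rfl
    by_cases hlen : s.len j < l
    · rw [coord_of_lt h.independent hlen]; rfl
    have hout : ∀ m, s.len j < m → coord h.independent j m u = 0 := fun m hm => by
      rw [coord_of_lt h.independent hm]; rfl
    rcases hj : s.kind j with _ | w' | _ | _
    · simp only [hj, true_and, reduceCtorEq, false_and, or_false, Classical.not_imp] at hl
      obtain ⟨rfl, hl⟩ := hl
      obtain ⟨m, rfl⟩ : ∃ m, l = m + 1 := ⟨l - 1, by omega⟩
      rw [h.coord_singular hA hj (by omega) (by omega), zero_smul, add_zero]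
      exact hw0 (by simp [hj]; omega)
    · by_cases hz : w' = z
      · subst hz
        simp only [hj, reduceCtorEq, false_and, false_or, true_and] at hl
        obtain ⟨m, rfl⟩ : ∃ m, l = m + 1 := ⟨l - 1, by omega⟩
        have e := h.coord_finite hA hj (k := m) (by omega)
        rw [map_add, map_smul, smul_eq_mul, hw0 (by simp [hj]; omega)] at e
        linear_combination e
      · refine eq_zero_of_backward (a := fun m => coord h.independent j m u)
          (c := -(w' - z)⁻¹) (fun m hm => ?_) hout hl0
        have e := h.coord_finite hA hj hm
        rw [map_add, map_smul, smul_eq_mul, hw0 (by simp [hj, hz])] at e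
        have hne : w' - z ≠ 0 := sub_ne_zero.2 hz
        field_simp
        linear_combination e
    · refine eq_zero_of_backward (a := fun m => coord h.independent j m u)
          (c := z) (fun m hm => ?_) hout hl0
      have e := h.coord_infinite hA hj hm
      rw [map_add, map_smul, smul_eq_mul, hw0 (by simp [hj]), zero_add] at e
      exact e
    · refine eq_zero_of_backward (a := fun m => coord h.independent j m u)
          (c := z) (fun m hm => ?_) hout hl0
      have e := h.coord_shift hA hj m
      rw [map_add, map_smul, smul_eq_mul, hw0 (by simp [hj]), zero_add] at e
      exact e

theorem mul_power_le (h : IsChainDecomp A s x) (k : ℕ) :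
    mul (power A k) ≤ posSpan s x (fun j l =>
      s.kind j = .singular ∨ (s.kind j = .infinite ∧ l ≤ k)) := by
  induction k with
  | zero =>
    intro u hu
    rw [mem_mul_power_zero.1 hu]
    exact Submodule.zero_mem _
  | succ k ih =>
    intro v hv
    obtain ⟨w, hw, hA⟩ := mem_mul_power_succ.1 hv
    have hw0 := fun {j l} hl => coord_eq_zero_of_mem_posSpan h.independent (ih hw) (j := j) (k := l) hl
    refine mem_posSpan_of_coord h.independent (h.right_mem hA) fun j l hl => ?_
    rcases Nat.eq_zero_or_pos l with rfl | hl0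
    · rw [coord_zero_right]; rfl
    rcases hj : s.kind j with _ | w' | _ | _
    · exact absurd (Or.inl hj) hl
    · rw [← h.coord_finite hA hj hl0, hw0 (by simp [hj]), hw0 (by simp [hj]), mul_zero, add_zero]
    · obtain ⟨m, rfl⟩ : ∃ m, l = m + 1 := ⟨l - 1, by omega⟩
      simp only [hj, reduceCtorEq, false_or, true_and] at hl
      rw [← h.coord_infinite hA hj (by omega), hw0 (by simp [hj]; omega)]
    · obtain ⟨m, rfl⟩ : ∃ m, l = m + 1 := ⟨l - 1, by omega⟩
      rw [← h.coord_shift hA hj, hw0 (by simp [hj])]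

theorem ran_power_le (h : IsChainDecomp A s x) (k : ℕ) :
    ran (power A (k + 1)) ≤ posSpan s x (fun j l => s.kind j = .shift → k + 1 < l) := by
  induction k with
  | zero =>
    intro v hv
    obtain ⟨w, -, hA⟩ := mem_ran_power_succ.1 hv
    refine mem_posSpan_of_coord h.independent (h.right_mem hA) fun j l hl => ?_
    obtain ⟨hj, hl⟩ := Classical.not_imp.1 hl
    obtain rfl | rfl : l = 0 ∨ l = 1 := by omega
    · rw [coord_zero_right]; rfl
    · rw [← h.coord_shift hA hj, coord_zero_right]; rfl
  | succ k ih =>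
    intro v hv
    obtain ⟨w, hw, hA⟩ := mem_ran_power_succ.1 hv
    refine mem_posSpan_of_coord h.independent (h.right_mem hA) fun j l hl => ?_
    obtain ⟨hj, hl⟩ := Classical.not_imp.1 hl
    rcases Nat.eq_zero_or_pos l with rfl | hl0
    · rw [coord_zero_right]; rfl
    obtain ⟨m, rfl⟩ : ∃ m, l = m + 1 := ⟨l - 1, by omega⟩
    rw [← h.coord_shift hA hj]
    exact coord_eq_zero_of_mem_posSpan h.independent (ih hw) (by simp [hj]; omega)

theorem pair_mem (h : IsChainDecomp A s x) {κ : PartKind} {j : Fin s.num} (hj : s.kind j = κ)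
    {p : H × H} (hp : p ∈ chainPairs (s.len j) (entry s x j) κ) :
    p ∈ restrict A (chainSpace s x κ) := by
  have := mem_chainRel hj hp
  refine ⟨?_, chainRel_le_prod κ this⟩
  rw [h.rel_eq]
  exact Submodule.mem_iSup_of_mem κ this

end IsChainDecomp

section ChainsInRelation

variable {B : LinRel H} {j : Fin s.num}

theorem entry_mem_ker_of_singular
    (hB : ∀ p ∈ chainPairs (s.len j) (entry s x j) .singular, p ∈ B) (k l : ℕ) (hl : l ≤ k) :
    entry s x j l ∈ ker (power B k) := by
  by_cases hlen : l ≤ s.len j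
  · exact mem_ker_power_of_chain (entry_zero j)
      (fun k hk => hB _ ⟨k, hk.le, rfl⟩) k l hl hlen
  · rw [entry_eq_zero_of_lt (by omega)]; exact Submodule.zero_mem _

theorem entry_mem_rootSpace_of_singular
    (hB : ∀ p ∈ chainPairs (s.len j) (entry s x j) .singular, p ∈ B) (z : ℂ) (l : ℕ) :
    entry s x j l ∈ rootSpace B z :=
  mem_rootSpace_of_singular_chain (entry_zero j) (fun _ hk => entry_eq_zero_of_lt hk)
    (fun k hk => hB _ ⟨k, hk, rfl⟩) z l

theorem entry_mem_rootSpaceInfty_of_singular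
    (hB : ∀ p ∈ chainPairs (s.len j) (entry s x j) .singular, p ∈ B) (l : ℕ) :
    entry s x j l ∈ rootSpaceInfty B := by
  by_cases hlen : l ≤ s.len j + 1
  · have hm := mem_mul_power_of_chain (B := B) (e := fun k => entry s x j (s.len j + 1 - k))
      (n := s.len j + 1) (entry_eq_zero_of_lt (by omega)) (fun k hk => by
        refine hB _ ⟨s.len j - k, by omega, ?_⟩
        rw [show s.len j + 1 - k = s.len j - k + 1 by omega,
          show s.len j + 1 - (k + 1) = s.len j - k by omega])
      (s.len j + 1) (s.len j + 1 - l) (by omega) (by omega)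
    rw [show s.len j + 1 - (s.len j + 1 - l) = l by omega] at hm
    exact le_iSup (fun i => mul (power B i)) (s.len j + 1) hm
  · rw [entry_eq_zero_of_lt (by omega)]; exact Submodule.zero_mem _

theorem entry_mem_singularSpace_of_singular
    (hB : ∀ p ∈ chainPairs (s.len j) (entry s x j) .singular, p ∈ B) (l : ℕ) :
    entry s x j l ∈ singularSpace B :=
  ⟨entry_mem_rootSpace_of_singular hB 0 l, entry_mem_rootSpaceInfty_of_singular hB l⟩

theorem entry_mem_ker_of_finite {z : ℂ}
    (hB : ∀ p ∈ chainPairs (s.len j) (entry s x j) (.finite z), p ∈ B) (k l : ℕ) (hl : l ≤ k) :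
    entry s x j l ∈ ker (power (subScalar B z) k) := by
  by_cases hlen : l ≤ s.len j
  · exact mem_ker_power_of_chain (entry_zero j)
      (fun k hk => mem_subScalar.2 (hB _ ⟨k, hk, rfl⟩)) k l hl hlen
  · rw [entry_eq_zero_of_lt (by omega)]; exact Submodule.zero_mem _

theorem entry_mem_mul_of_infinite
    (hB : ∀ p ∈ chainPairs (s.len j) (entry s x j) .infinite, p ∈ B) (k l : ℕ) (hl : l ≤ k) :
    entry s x j l ∈ mul (power B k) := by
  by_cases hlen : l ≤ s.len j
  · exact mem_mul_power_of_chain (entry_zero j)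
      (fun k hk => hB _ ⟨k, hk, rfl⟩) k l hl hlen
  · rw [entry_eq_zero_of_lt (by omega)]; exact Submodule.zero_mem _

theorem entry_mem_ran_of_shift
    (hB : ∀ p ∈ chainPairs (s.len j) (entry s x j) .shift, p ∈ B) (k l : ℕ) (hl : k < l) :
    entry s x j l ∈ ran (power B k) := by
  by_cases hlen : l ≤ s.len j
  · exact mem_ran_power_of_chain (fun k h1 hk => hB _ ⟨k, h1, hk, rfl⟩) k l hl hlen
  · rw [entry_eq_zero_of_lt (by omega)]; exact Submodule.zero_mem _

end ChainsInRelation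

end Computation

/-! ### A chain decomposition is built along the quotient spaces -/

section Properties

variable {H : Type*} [AddCommGroup H] [Module ℂ H]
  {A : LinRel H} {s : ChainShape} {x : s.Index → H}

theorem posSpan_congr {P Q : Fin s.num → ℕ → Prop}
    (hPQ : ∀ j l, 1 ≤ l → l ≤ s.len j → (P j l ↔ Q j l)) : posSpan s x P = posSpan s x Q :=
  le_antisymm
    (posSpan_le fun j l hP h1 h2 => entry_mem_posSpan ((hPQ j l h1 h2).1 hP))
    (posSpan_le fun j l hQ h1 h2 => entry_mem_posSpan ((hPQ j l h1 h2).2 hQ))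

theorem mem_inverse {A : LinRel H} {u v : H} : (u, v) ∈ inverse A ↔ (v, u) ∈ A := Iff.rfl

namespace IsChainDecomp

theorem pair_mem' (h : IsChainDecomp A s x) {κ : PartKind} {j : Fin s.num} (hj : s.kind j = κ) :
    ∀ p ∈ chainPairs (s.len j) (entry s x j) κ, p ∈ A := fun _ hp => (h.pair_mem hj hp).1

theorem rootSpace_eq_posSpan (h : IsChainDecomp A s x) (z : ℂ) :
    rootSpace A z = posSpan s x (fun j _ => s.kind j = .singular ∨ s.kind j = .finite z) := by
  refine le_antisymm (iSup_le fun k => (h.ker_power_le z k).trans (posSpan_mono ?_))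
    (posSpan_le ?_)
  · rintro j l (hj | hj)
    · exact Or.inl hj.1
    · exact Or.inr hj.1
  · rintro j l (hj | hj) _ _
    · exact entry_mem_rootSpace_of_singular (h.pair_mem' hj) z l
    · exact le_iSup (fun i => ker (power (subScalar A z) i)) l
        (entry_mem_ker_of_finite (h.pair_mem' hj) l l le_rfl)

theorem rootSpaceInfty_eq_posSpan (h : IsChainDecomp A s x) :
    rootSpaceInfty A = posSpan s x (fun j _ => s.kind j = .singular ∨ s.kind j = .infinite) := by
  refine le_antisymm (iSup_le fun k => (h.mul_power_le k).trans (posSpan_mono ?_))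
    (posSpan_le ?_)
  · rintro j l (hj | hj)
    · exact Or.inl hj
    · exact Or.inr hj.1
  · rintro j l (hj | hj) _ _
    · exact entry_mem_rootSpaceInfty_of_singular (h.pair_mem' hj) l
    · exact le_iSup (fun i => mul (power A i)) l
        (entry_mem_mul_of_infinite (h.pair_mem' hj) l l le_rfl)

theorem singularSpace_eq_posSpan (h : IsChainDecomp A s x) :
    singularSpace A = posSpan s x (fun j _ => s.kind j = .singular) := by
  rw [singularSpace, h.rootSpace_eq_posSpan, h.rootSpaceInfty_eq_posSpan,
    posSpan_inf h.independent]
  refine posSpan_congr fun j _ _ _ => ?_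
  rcases s.kind j <;> simp

theorem totalRootSpace_eq_posSpan (h : IsChainDecomp A s x) :
    totalRootSpace A = posSpan s x (fun j _ => s.kind j ≠ .shift) := by
  rw [totalRootSpace, h.rootSpaceInfty_eq_posSpan]
  refine le_antisymm (sup_le (iSup_le fun z => ?_) (posSpan_mono ?_)) (posSpan_le ?_)
  · rw [h.rootSpace_eq_posSpan]
    refine posSpan_mono ?_
    rintro j - (hj | hj) <;> simp [hj]
  · rintro j - (hj | hj) <;> simp [hj]
  · intro j l hj _ _
    rcases hk : s.kind j with _ | z | _ | _
    · exact Submodule.mem_sup_right (entry_mem_posSpan (Or.inl hk))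
    · refine Submodule.mem_sup_left (Submodule.mem_iSup_of_mem z ?_)
      rw [h.rootSpace_eq_posSpan]
      exact entry_mem_posSpan (Or.inr hk)
    · exact Submodule.mem_sup_right (entry_mem_posSpan (Or.inr hk))
    · exact absurd hk hj

theorem ker_power_inf_eq (h : IsChainDecomp A s x) (k : ℕ) :
    ker (power A k) ⊓ singularSpace A =
      posSpan s x (fun j l => s.kind j = .singular ∧ l ≤ k) := by
  refine le_antisymm ?_ (posSpan_le fun j l hj _ _ =>
    ⟨entry_mem_ker_of_singular (h.pair_mem' hj.1) k l hj.2,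
      entry_mem_singularSpace_of_singular (h.pair_mem' hj.1) l⟩)
  have h1 := h.ker_power_le 0 k
  rw [subScalar_zero] at h1
  refine (inf_le_inf h1 h.singularSpace_eq_posSpan.le).trans ?_
  rw [posSpan_inf h.independent]
  refine posSpan_mono ?_
  rintro j l ⟨h1 | h1, h2⟩
  · exact ⟨h2, h1.2 rfl⟩
  · simp [h1.1] at h2

theorem ker_power_sup_eq (h : IsChainDecomp A s x) (z : ℂ) (k : ℕ) :
    ker (power (subScalar A z) k) ⊔ singularSpace A =
      posSpan s x (fun j l => s.kind j = .singular ∨ (s.kind j = .finite z ∧ l ≤ k)) := by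
  refine le_antisymm (sup_le ((h.ker_power_le z k).trans (posSpan_mono ?_)) ?_) (posSpan_le ?_)
  · rintro j l (h1 | h1)
    · exact Or.inl h1.1
    · exact Or.inr h1
  · rw [h.singularSpace_eq_posSpan]
    exact posSpan_mono fun _ _ => Or.inl
  · rintro j l (hj | hj) _ _
    · exact Submodule.mem_sup_right (entry_mem_singularSpace_of_singular (h.pair_mem' hj) l)
    · exact Submodule.mem_sup_left (entry_mem_ker_of_finite (h.pair_mem' hj.1) k l hj.2)

theorem mul_power_sup_eq (h : IsChainDecomp A s x) (k : ℕ) :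
    mul (power A k) ⊔ singularSpace A =
      posSpan s x (fun j l => s.kind j = .singular ∨ (s.kind j = .infinite ∧ l ≤ k)) := by
  refine le_antisymm (sup_le (h.mul_power_le k) ?_) (posSpan_le ?_)
  · rw [h.singularSpace_eq_posSpan]
    exact posSpan_mono fun _ _ => Or.inl
  · rintro j l (hj | hj) _ _
    · exact Submodule.mem_sup_right (entry_mem_singularSpace_of_singular (h.pair_mem' hj) l)
    · exact Submodule.mem_sup_left (entry_mem_mul_of_infinite (h.pair_mem' hj.1) k l hj.2)

theorem ran_power_sup_eq (h : IsChainDecomp A s x) (k : ℕ) :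
    ran (power A (k + 1)) ⊔ totalRootSpace A =
      posSpan s x (fun j l => s.kind j = .shift → k + 1 < l) := by
  refine le_antisymm (sup_le (h.ran_power_le k) ?_) (posSpan_le fun j l hj _ _ => ?_)
  · rw [h.totalRootSpace_eq_posSpan]
    exact posSpan_mono fun _ _ h1 h2 => absurd h2 h1
  · by_cases hs : s.kind j = .shift
    · exact Submodule.mem_sup_left (entry_mem_ran_of_shift (h.pair_mem' hs) _ l (hj hs))
    · rw [h.totalRootSpace_eq_posSpan]
      exact Submodule.mem_sup_right (entry_mem_posSpan hs)

theorem classes_basis (h : IsChainDecomp A s x) (κ : PartKind) (k : ℕ) :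
    ClassesFormBasis (quotNum A κ k) (quotDen A κ k)
      (fun j : {j : Fin s.num // s.kind j = κ ∧ k < s.len j} => x ⟨j.1, ⟨k, j.2.2⟩⟩) := by
  have main : ∀ {N D : Submodule ℂ H} (P Q : Fin s.num → ℕ → Prop), N = posSpan s x P →
      D = posSpan s x Q →
      (∀ j l, 1 ≤ l → l ≤ s.len j → (P j l ∧ ¬ Q j l ↔ s.kind j = κ ∧ l = k + 1)) →
      ClassesFormBasis N D
        (fun j : {j : Fin s.num // s.kind j = κ ∧ k < s.len j} => x ⟨j.1, ⟨k, j.2.2⟩⟩) := by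
    rintro _ _ P Q rfl rfl hPQ
    refine classesFormBasis_posSpan h.independent
      (fun j : {j : Fin s.num // s.kind j = κ ∧ k < s.len j} => ⟨j.1, ⟨k, j.2.2⟩⟩) ?_ ?_ ?_ ?_
    · intro j j' hjj
      exact Subtype.ext (Sigma.mk.inj hjj).1
    · rintro ⟨j, l⟩ hP hQ
      obtain ⟨hj, hl⟩ := (hPQ j (l + 1) (by omega) l.2).1 ⟨hP, hQ⟩
      have hl' : (l : ℕ) = k := by omega
      subst hl'
      exact ⟨⟨j, hj, l.2⟩, rfl⟩
    · exact fun i => ((hPQ i.1 (k + 1) (by omega) i.2.2).2 ⟨i.2.1, rfl⟩).1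
    · exact fun i => ((hPQ i.1 (k + 1) (by omega) i.2.2).2 ⟨i.2.1, rfl⟩).2
  rcases κ with _ | z | _ | _
  · refine main _ _ (h.ker_power_inf_eq (k + 1)) (h.ker_power_inf_eq k) fun j l _ _ => ?_
    by_cases hj : s.kind j = .singular <;> simp [hj]
    omega
  · refine main _ _ (h.ker_power_sup_eq z (k + 1)) (h.ker_power_sup_eq z k) fun j l _ _ => ?_
    by_cases hj : s.kind j = .finite z <;> simp [hj]
    omega
  · refine main _ _ (h.mul_power_sup_eq (k + 1)) (h.mul_power_sup_eq k) fun j l _ _ => ?_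
    by_cases hj : s.kind j = .infinite <;> simp [hj]
    omega
  · have hnum : quotNum A .shift k = posSpan s x (fun j l => s.kind j = .shift → k < l) := by
      rcases k with _ | k
      · refine h.support_eq_posSpan.trans (posSpan_congr fun j l hl _ => ?_)
        simp; omega
      · exact h.ran_power_sup_eq k
    refine main _ _ hnum (h.ran_power_sup_eq k) fun j l _ _ => ?_
    by_cases hj : s.kind j = .shift <;> simp [hj]
    omega

theorem iSupIndep_chainSpace (h : IsChainDecomp A s x) : iSupIndep (chainSpace s x) := by
  intro κ
  rw [disjoint_iff, eq_bot_iff]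
  have h1 : ⨆ κ', ⨆ (_ : κ' ≠ κ), chainSpace s x κ' ≤ posSpan s x (fun j _ => s.kind j ≠ κ) := by
    refine iSup₂_le fun κ' hκ => ?_
    rw [chainSpace_eq_posSpan]
    exact posSpan_mono fun j _ hj => hj ▸ hκ
  refine (inf_le_inf (chainSpace_eq_posSpan κ).le h1).trans ?_
  rw [posSpan_inf h.independent]
  exact posSpan_le fun j l hj _ _ => absurd hj.1 hj.2

theorem restrict_eq_chainRel (h : IsChainDecomp A s x) (κ : PartKind) :
    restrict A (chainSpace s x κ) = chainRel s x κ := by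
  refine le_antisymm ?_ (chainRel_le fun j hj p hp => h.pair_mem hj hp)
  rintro ⟨u, v⟩ ⟨hA, hu, hv⟩
  have hsplit : A ≤ chainRel s x κ ⊔ ⨆ κ', ⨆ (_ : κ' ≠ κ), chainRel s x κ' := by
    conv_lhs => rw [h.rel_eq]
    refine iSup_le fun κ' => ?_
    by_cases hκ : κ' = κ
    · subst hκ; exact le_sup_left
    · exact le_sup_of_le_right (le_iSup₂_of_le κ' hκ le_rfl)
  obtain ⟨p, hp, q, hq, hpq⟩ := Submodule.mem_sup.1 (hsplit hA)
  -- The part of `(u, v)` in the other types has both components in the intersection of the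
  -- space of type `κ` with the sum of the other spaces, which is zero.
  have hle : ⨆ κ', ⨆ (_ : κ' ≠ κ), chainRel s x κ' ≤
      (⨆ κ', ⨆ (_ : κ' ≠ κ), chainSpace s x κ').prod
        (⨆ κ', ⨆ (_ : κ' ≠ κ), chainSpace s x κ') := by
    refine iSup₂_le fun κ' hκ => (chainRel_le_prod κ').trans ?_
    exact Submodule.prod_mono (le_iSup₂_of_le κ' hκ le_rfl) (le_iSup₂_of_le κ' hκ le_rfl)
  have hq' := hle hq
  have hp' := chainRel_le_prod κ hp
  have hd := Submodule.disjoint_def.1 (h.iSupIndep_chainSpace κ)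
  have e1 : p.1 + q.1 = u := congrArg Prod.fst hpq
  have e2 : p.2 + q.2 = v := congrArg Prod.snd hpq
  have q1 : q.1 = 0 := hd _ (by
    rw [← eq_sub_iff_add_eq'] at e1
    rw [e1]; exact Submodule.sub_mem _ hu hp'.1) hq'.1
  have q2 : q.2 = 0 := hd _ (by
    rw [← eq_sub_iff_add_eq'] at e2
    rw [e2]; exact Submodule.sub_mem _ hv hp'.2) hq'.2
  rw [q1, add_zero] at e1
  rw [q2, add_zero] at e2
  rw [← e1, ← e2]
  exact hp

theorem isJordanLike (h : IsChainDecomp A s x) : IsJordanLike A s x where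
  independent := h.independent
  singular_eq := by rw [h.singularSpace_eq_posSpan, chainSpace_eq_posSpan]
  support_eq := h.support_eq
  reducing :=
    { spaces_independent := h.iSupIndep_chainSpace
      parts_independent := by
        intro κ
        rw [Submodule.disjoint_def]
        rintro ⟨u, v⟩ h1 h2
        have hle : ⨆ κ', ⨆ (_ : κ' ≠ κ), restrict A (chainSpace s x κ') ≤
            (⨆ κ', ⨆ (_ : κ' ≠ κ), chainSpace s x κ').prod
              (⨆ κ', ⨆ (_ : κ' ≠ κ), chainSpace s x κ') :=
          iSup₂_le fun κ' hκ => inf_le_right.trans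
            (Submodule.prod_mono (le_iSup₂_of_le κ' hκ le_rfl) (le_iSup₂_of_le κ' hκ le_rfl))
        have hd := Submodule.disjoint_def.1 (h.iSupIndep_chainSpace κ)
        have h1' := (mem_restrict.1 h1).2
        have h2' := hle h2
        exact Prod.ext (hd _ h1'.1 h2'.1) (hd _ h1'.2 h2'.2)
      sum_eq := h.rel_eq.trans (iSup_congr fun κ => (h.restrict_eq_chainRel κ).symm) }
  part_eq := h.restrict_eq_chainRel

theorem entry_ne_zero (h : IsChainDecomp A s x) (j : Fin s.num) : entry s x j 1 ≠ 0 := by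
  have := h.independent.ne_zero ⟨j, ⟨0, s.len_pos j⟩⟩
  rwa [← entry_succ (x := x)] at this

theorem entry_notMem (h : IsChainDecomp A s x) {P : Fin s.num → ℕ → Prop} {j : Fin s.num}
    (hj : ¬ P j 1) : entry s x j 1 ∉ posSpan s x P := by
  intro hm
  have h1 := coord_eq_zero_of_mem_posSpan h.independent hm hj
  rw [coord_entry, if_pos ⟨rfl, rfl, le_rfl, s.len_pos j⟩] at h1
  exact one_ne_zero h1

theorem entry_one_mem_ker (h : IsChainDecomp A s x) {j : Fin s.num} {z : ℂ}
    (hj : s.kind j = .finite z) :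
    entry s x j 1 ∈ ker (subScalar (restrict A (chainSpace s x (.finite z))) z) := by
  have := h.pair_mem hj ⟨0, s.len_pos j, rfl⟩
  rw [mem_ker, mem_subScalar]
  rwa [entry_zero] at this

theorem entry_one_mem_mul (h : IsChainDecomp A s x) {j : Fin s.num} (hj : s.kind j = .infinite) :
    entry s x j 1 ∈ mul (restrict A (chainSpace s x .infinite)) := by
  have := h.pair_mem hj ⟨0, s.len_pos j, rfl⟩
  rwa [entry_zero] at this

theorem coe_mem_properPointSpectrum_iff (h : IsChainDecomp A s x) (z : ℂ) :
    (z : OnePoint ℂ) ∈ properPointSpectrum A ↔ ∃ j, s.kind j = .finite z := by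
  constructor
  · rintro ⟨-, ⟨z', hz, u, hu, hu'⟩ | ⟨hz, -⟩⟩
    · obtain rfl := OnePoint.coe_injective hz
      by_contra! hne
      refine hu' ?_
      rw [SetLike.mem_coe, h.singularSpace_eq_posSpan]
      rw [SetLike.mem_coe, h.rootSpace_eq_posSpan] at hu
      exact posSpan_mono (fun j _ hj => hj.resolve_right (hne j)) hu
    · exact absurd hz (OnePoint.coe_ne_infty z)
  · rintro ⟨j, hj⟩
    refine ⟨Or.inl ⟨z, rfl, fun h0 => h.entry_ne_zero j ?_⟩, Or.inl ⟨z, rfl, entry s x j 1, ?_, ?_⟩⟩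
    · have := mem_restrict.1 (mem_subScalar.1 (h.entry_one_mem_ker hj))
      have hk : entry s x j 1 ∈ ker (subScalar A z) := mem_subScalar.2 this.1
      rwa [h0] at hk
    · rw [SetLike.mem_coe, h.rootSpace_eq_posSpan]
      exact entry_mem_posSpan (Or.inr hj)
    · rw [SetLike.mem_coe, h.singularSpace_eq_posSpan]
      exact h.entry_notMem (by simp [hj])

theorem infty_mem_properPointSpectrum_iff (h : IsChainDecomp A s x) :
    OnePoint.infty ∈ properPointSpectrum A ↔ ∃ j, s.kind j = .infinite := by
  constructor
  · rintro ⟨-, ⟨z', hz, -⟩ | ⟨-, u, hu, hu'⟩⟩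
    · exact absurd hz (OnePoint.infty_ne_coe z')
    · by_contra! hne
      refine hu' ?_
      rw [SetLike.mem_coe, h.singularSpace_eq_posSpan]
      rw [SetLike.mem_coe, h.rootSpaceInfty_eq_posSpan] at hu
      exact posSpan_mono (fun j _ hj => hj.resolve_right (hne j)) hu
  · rintro ⟨j, hj⟩
    refine ⟨Or.inr ⟨rfl, fun h0 => h.entry_ne_zero j ?_⟩, Or.inr ⟨rfl, entry s x j 1, ?_, ?_⟩⟩
    · have := (mem_restrict.1 (h.entry_one_mem_mul hj)).1
      have hk : entry s x j 1 ∈ mul A := this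
      rwa [h0] at hk
    · rw [SetLike.mem_coe, h.rootSpaceInfty_eq_posSpan]
      exact entry_mem_posSpan (Or.inr hj)
    · rw [SetLike.mem_coe, h.singularSpace_eq_posSpan]
      exact h.entry_notMem (by simp [hj])

theorem chainSpace_eq_bot {κ : PartKind} (hκ : ∀ j, s.kind j ≠ κ) : chainSpace s x κ = ⊥ := by
  rw [eq_bot_iff, chainSpace_eq_posSpan]
  exact posSpan_le fun j _ hj _ _ => absurd hj (hκ j)

/-- An eigenvector at `z` that lies in the space of a type other than the singular one and the
Jordan type at `z` vanishes. -/
theorem eq_zero_of_mem_ker (h : IsChainDecomp A s x) {κ : PartKind} {z : ℂ} {u : H}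
    (hu : (u, z • u) ∈ A) (hκ : u ∈ chainSpace s x κ) (h1 : κ ≠ .singular)
    (h2 : κ ≠ .finite z) : u = 0 := by
  have hk : u ∈ rootSpace A z := le_iSup (fun i => ker (power (subScalar A z) i)) 1
    (mem_ker_power_succ.2 ⟨0, mem_subScalar.2 (by simpa using hu), mem_ker_power_zero.2 rfl⟩)
  rw [h.rootSpace_eq_posSpan] at hk
  rw [chainSpace_eq_posSpan] at hκ
  have := Submodule.mem_inf.2 ⟨hk, hκ⟩
  rw [posSpan_inf h.independent] at this
  refine (Submodule.mem_bot ℂ).1 (posSpan_le ?_ this)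
  rintro j l ⟨hj | hj, rfl⟩ _ _
  · exact absurd hj h1
  · exact absurd hj h2

theorem eq_zero_of_mem_mul (h : IsChainDecomp A s x) {κ : PartKind} {v : H}
    (hv : ((0 : H), v) ∈ A) (hκ : v ∈ chainSpace s x κ) (h1 : κ ≠ .singular)
    (h2 : κ ≠ .infinite) : v = 0 := by
  have hk : v ∈ rootSpaceInfty A := le_iSup (fun i => mul (power A i)) 1
    (mem_mul_power_succ.2 ⟨0, mem_mul_power_zero.2 rfl, hv⟩)
  rw [h.rootSpaceInfty_eq_posSpan] at hk
  rw [chainSpace_eq_posSpan] at hκ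
  have := Submodule.mem_inf.2 ⟨hk, hκ⟩
  rw [posSpan_inf h.independent] at this
  refine (Submodule.mem_bot ℂ).1 (posSpan_le ?_ this)
  rintro j l ⟨hj | hj, rfl⟩ _ _
  · exact absurd hj h1
  · exact absurd hj h2

theorem isJordanOperator (h : IsChainDecomp A s x) {z : ℂ} (hz : ∃ j, s.kind j = .finite z) :
    IsJordanOperator (restrict A (chainSpace s x (.finite z))) (chainSpace s x (.finite z)) z := by
  refine ⟨inf_le_right, le_antisymm ?_ ?_, ?_, Set.Subset.antisymm ?_ ?_⟩
  · intro u hu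
    obtain ⟨v, hv⟩ := mem_dom.1 hu
    exact (mem_restrict.1 hv).2.1
  · nth_rw 1 [chainSpace_eq_posSpan]
    refine posSpan_le fun j l hj h1 h2 => mem_dom.2 ⟨entry s x j (l - 1) + z • entry s x j l, ?_⟩
    obtain ⟨m, rfl⟩ : ∃ m, l = m + 1 := ⟨l - 1, by omega⟩
    exact h.pair_mem hj ⟨m, by omega, rfl⟩
  · rw [eq_bot_iff]
    intro v hv
    have hv := mem_restrict.1 (mem_mul.1 hv)
    exact h.eq_zero_of_mem_mul hv.1 hv.2.2 (by simp) (by simp)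
  · rintro w (⟨z', rfl, hz'⟩ | ⟨rfl, hz'⟩)
    · obtain ⟨u, hu, hu0⟩ := Submodule.exists_mem_ne_zero_of_ne_bot hz'
      have hu := mem_restrict.1 (mem_subScalar.1 (mem_ker.1 hu))
      by_contra hne
      refine hu0 (h.eq_zero_of_mem_ker (z := z') (by simpa using hu.1) hu.2.1 (by simp) ?_)
      rintro heq
      refine hne ?_
      rw [PartKind.finite.inj heq]; rfl
    · obtain ⟨v, hv, hv0⟩ := Submodule.exists_mem_ne_zero_of_ne_bot hz'
      have hv := mem_restrict.1 (mem_mul.1 hv)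
      exact absurd (h.eq_zero_of_mem_mul hv.1 hv.2.2 (by simp) (by simp)) hv0
  · rintro _ rfl
    obtain ⟨j, hj⟩ := hz
    refine Or.inl ⟨z, rfl, fun h0 => h.entry_ne_zero j ?_⟩
    have := h.entry_one_mem_ker hj
    rwa [h0] at this

theorem isJordanRelation (h : IsChainDecomp A s x) (hz : ∃ j, s.kind j = .infinite) :
    IsJordanRelation (restrict A (chainSpace s x .infinite)) (chainSpace s x .infinite) := by
  refine ⟨?_, le_antisymm ?_ ?_, ?_, Set.Subset.antisymm ?_ ?_⟩
  · rintro ⟨u, v⟩ huv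
    exact ⟨(mem_restrict.1 huv).2.2, (mem_restrict.1 huv).2.1⟩
  · intro u hu
    obtain ⟨v, hv⟩ := mem_dom.1 hu
    exact (mem_restrict.1 (mem_inverse.1 hv)).2.2
  · nth_rw 1 [chainSpace_eq_posSpan]
    refine posSpan_le fun j l hj h1 h2 => mem_dom.2
      ⟨entry s x j (l - 1), mem_inverse.2 ?_⟩
    obtain ⟨m, rfl⟩ : ∃ m, l = m + 1 := ⟨l - 1, by omega⟩
    exact h.pair_mem hj ⟨m, by omega, rfl⟩
  · rw [eq_bot_iff]
    intro u hu
    have hu := mem_restrict.1 (mem_inverse.1 (mem_mul.1 hu))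
    exact h.eq_zero_of_mem_ker (z := 0) (by simpa using hu.1) hu.2.1 (by simp) (by simp)
  · rintro w (⟨z', rfl, hz'⟩ | ⟨rfl, hz'⟩)
    · obtain ⟨u, hu, hu0⟩ := Submodule.exists_mem_ne_zero_of_ne_bot hz'
      have hu := mem_restrict.1 (mem_inverse.1 (mem_subScalar.1 (mem_ker.1 hu)))
      by_contra hne
      have hz0 : z' ≠ 0 := fun h0 => hne (by rw [h0]; rfl)
      rw [zero_add] at hu
      have hu1 : z' • u = 0 := h.eq_zero_of_mem_ker (z := z'⁻¹) (by simpa [hz0] using hu.1) hu.2.1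
        (by simp) (by simp)
      exact hu0 ((smul_eq_zero.1 hu1).resolve_left hz0)
    · obtain ⟨u, hu, hu0⟩ := Submodule.exists_mem_ne_zero_of_ne_bot hz'
      have hu := mem_restrict.1 (mem_inverse.1 (mem_mul.1 hu))
      exact absurd (h.eq_zero_of_mem_ker (z := 0) (by simpa using hu.1) hu.2.1 (by simp)
        (by simp)) hu0
  · rintro _ rfl
    obtain ⟨j, hj⟩ := hz
    refine Or.inl ⟨0, rfl, fun h0 => h.entry_ne_zero j ?_⟩
    have : entry s x j 1 ∈ ker (subScalar (inverse (restrict A (chainSpace s x .infinite))) 0) := by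
      rw [subScalar_zero]; exact h.entry_one_mem_mul hj
    rwa [h0] at this

theorem isMultishift (h : IsChainDecomp A s x) :
    IsMultishift (restrict A (chainSpace s x .shift)) := by
  refine Set.eq_empty_iff_forall_notMem.2 ?_
  rintro w (⟨z', rfl, hz'⟩ | ⟨rfl, hz'⟩)
  · obtain ⟨u, hu, hu0⟩ := Submodule.exists_mem_ne_zero_of_ne_bot hz'
    have hu := mem_restrict.1 (mem_subScalar.1 (mem_ker.1 hu))
    exact hu0 (h.eq_zero_of_mem_ker (z := z') (by simpa using hu.1) hu.2.1 (by simp) (by simp))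
  · obtain ⟨v, hv, hv0⟩ := Submodule.exists_mem_ne_zero_of_ne_bot hz'
    have hv := mem_restrict.1 (mem_mul.1 hv)
    exact hv0 (h.eq_zero_of_mem_mul hv.1 hv.2.2 (by simp) (by simp))

theorem isCompletelySingular (h : IsChainDecomp A s x) :
    IsCompletelySingular (restrict A (chainSpace s x .singular)) := by
  refine le_antisymm (le_inf le_rfl (inf_le_right.trans ?_)) inf_le_left
  have : chainSpace s x .singular ≤ singularSpace (restrict A (chainSpace s x .singular)) := by
    nth_rw 1 [chainSpace_eq_posSpan]
    exact posSpan_le fun j l hj _ _ =>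
      entry_mem_singularSpace_of_singular (fun p hp => h.pair_mem hj hp) l
  exact Submodule.prod_mono this this

theorem isWeyrJordanLike (h : IsChainDecomp A s x) : IsWeyrJordanLike A s x where
  toIsJordanLike := h.isJordanLike
  classes_basis := h.classes_basis
  rootSpace_eq z := by
    rw [h.rootSpace_eq_posSpan, h.singularSpace_eq_posSpan, chainSpace_eq_posSpan, posSpan_sup]
  rootSpaceInfty_eq := by
    rw [h.rootSpaceInfty_eq_posSpan, h.singularSpace_eq_posSpan, chainSpace_eq_posSpan,
      posSpan_sup]
  singular_part := h.isCompletelySingular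
  finite_part z hz := h.isJordanOperator ((h.coe_mem_properPointSpectrum_iff z).1 hz)
  finite_absent z hz := chainSpace_eq_bot fun j hj =>
    hz ((h.coe_mem_properPointSpectrum_iff z).2 ⟨j, hj⟩)
  infinite_part hz := h.isJordanRelation (h.infty_mem_properPointSpectrum_iff.1 hz)
  infinite_absent hz := chainSpace_eq_bot fun j hj =>
    hz (h.infty_mem_properPointSpectrum_iff.2 ⟨j, hj⟩)
  shift_part := h.isMultishift

theorem quotDim_eq (h : IsChainDecomp A s x) (κ : PartKind) (k : ℕ) :
    quotDim A κ k = Nat.card {j : Fin s.num // s.kind j = κ ∧ k < s.len j} := by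
  obtain ⟨hmem, hli, hspan⟩ := h.classes_basis κ k
  classical
  have := Fintype.ofFinite {j : Fin s.num // s.kind j = κ ∧ k < s.len j}
  rw [quotDim, Module.finrank_eq_card_basis (Module.Basis.mk hli hspan.ge), Nat.card_eq_fintype_card]

end IsChainDecomp

end Properties

/-! ### String systems -/

section Strings

universe u

/-- Finitely many strings of vectors `e j 0 → ⋯ → e j (len j - 1)` in `V`, where `l j` and `r j`
record whether the string `j` also has an arrow `0 → e j 0` on the left and an arrow
`e j (len j - 1) → 0` on the right, together with a map `incl` into `V` from a coordinate space with
an automorphism `T`.  The values of `e j` beyond the length of the string are irrelevant. -/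
structure StringData (V : Type u) [AddCommGroup V] [Module ℂ V] where
  /-- the index set of the strings -/
  J : Type
  [fintypeJ : Fintype J]
  /-- the number of vectors in a string -/
  len : J → ℕ
  /-- whether there is an arrow from `0` to the first vector -/
  l : J → Bool
  /-- whether there is an arrow from the last vector to `0` -/
  r : J → Bool
  /-- the vectors of the strings -/
  e : J → ℕ → V
  /-- the dimension of the bijective part -/
  m : ℕ
  /-- the automorphism of the bijective part -/
  T : (Fin m → ℂ) ≃ₗ[ℂ] (Fin m → ℂ)
  /-- the position of the bijective part in `V` -/
  incl : (Fin m → ℂ) →ₗ[ℂ] V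

attribute [instance] StringData.fintypeJ

namespace StringData

variable {V : Type u} [AddCommGroup V] [Module ℂ V]

/-- The linear combination of the vectors of the strings and of the bijective part with given
coefficients. -/
noncomputable def comb (D : StringData V) : ((D.J → ℕ → ℂ) × (Fin D.m → ℂ)) →ₗ[ℂ] V :=
  ∑ j, ∑ i ∈ Finset.range (D.len j),
    (((LinearMap.proj i : (ℕ → ℂ) →ₗ[ℂ] ℂ).comp
      ((LinearMap.proj j : (D.J → ℕ → ℂ) →ₗ[ℂ] (ℕ → ℂ)).comp
        (LinearMap.fst ℂ _ _))).smulRight (D.e j i)) + D.incl.comp (LinearMap.snd ℂ _ _)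

theorem comb_apply (D : StringData V) (c : D.J → ℕ → ℂ) (w : Fin D.m → ℂ) :
    D.comb (c, w) = ∑ j, ∑ i ∈ Finset.range (D.len j), c j i • D.e j i + D.incl w := by
  simp [comb, LinearMap.sum_apply]

open Classical in
theorem comb_single (D : StringData V) {j : D.J} {i : ℕ} (hi : i < D.len j) :
    D.comb (fun j' i' => if j' = j ∧ i' = i then 1 else 0, 0) = D.e j i := by
  rw [comb_apply, map_zero, add_zero, Finset.sum_eq_single_of_mem j (Finset.mem_univ j),
    Finset.sum_eq_single_of_mem i (Finset.mem_range.2 hi)]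
  · simp
  · intro i' _ h; simp [h]
  · intro j' _ h; simp [h]

/-- All arrows of the string system belong to the relation `Q`. -/
structure PairsIn (D : StringData V) (Q : LinRel V) : Prop where
  arrow : ∀ j i, i + 1 < D.len j → (D.e j i, D.e j (i + 1)) ∈ Q
  left : ∀ j, D.l j = true → ((0 : V), D.e j 0) ∈ Q
  right : ∀ j, D.r j = true → (D.e j (D.len j - 1), (0 : V)) ∈ Q
  unit : ∀ w, (D.incl w, D.incl (D.T w)) ∈ Q

end StringData

variable {V : Type u} [AddCommGroup V] [Module ℂ V]

/-- The vectors of the string system are a basis of `V` (together with a basis of the bijective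
part), and its arrows span `A`. -/
structure IsStringDecomp (A : LinRel V) (D : StringData V) : Prop where
  len_pos : ∀ j, 0 < D.len j
  indep : ∀ c w, D.comb (c, w) = 0 → (∀ j i, i < D.len j → c j i = 0) ∧ w = 0
  span : ∀ P : Submodule ℂ V, (∀ j i, i < D.len j → D.e j i ∈ P) → (∀ w, D.incl w ∈ P) → P = ⊤
  pairs : D.PairsIn A
  gen : ∀ Q : LinRel V, D.PairsIn Q → A ≤ Q

namespace IsStringDecomp

theorem e_ne_zero {A : LinRel V} {D : StringData V} (h : IsStringDecomp A D) {j : D.J} {i : ℕ}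
    (hi : i < D.len j) : D.e j i ≠ 0 := by
  classical
  intro h0
  rw [← D.comb_single hi] at h0
  simpa using (h.indep _ _ h0).1 j i hi

/-- The last vectors of the strings without an arrow on the right are independent modulo `dom A`. -/
theorem last_indep {A : LinRel V} {D : StringData V} (h : IsStringDecomp A D) (d : D.J → ℂ)
    (hd : ∑ j, (if D.r j then 0 else d j • D.e j (D.len j - 1)) ∈ dom A) :
    ∀ j, D.r j = false → d j = 0 := by
  classical
  let N : Submodule ℂ ((D.J → ℕ → ℂ) × (Fin D.m → ℂ)) :=
    { carrier := {p | ∀ j, D.r j = false → p.1 j (D.len j - 1) = 0}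
      add_mem' := fun {p q} hp hq j hj => by simp [hp j hj, hq j hj]
      zero_mem' := fun j hj => rfl
      smul_mem' := fun a p hp j hj => by simp [hp j hj] }
  have hN : ∀ j i, i < D.len j → (D.r j = false → i ≠ D.len j - 1) → D.e j i ∈ N.map D.comb := by
    intro j i hi hr
    refine ⟨_, ?_, D.comb_single hi⟩
    intro j' hj'
    simp only [ite_eq_right_iff, one_ne_zero, imp_false]
    rintro ⟨rfl, h2⟩
    exact hr hj' h2.symm
  have hA : A ≤ (N.map D.comb).prod ⊤ := by
    refine h.gen _ ⟨fun j i hi => ⟨hN j i (by omega) (by omega), trivial⟩,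
      fun j _ => ⟨Submodule.zero_mem _, trivial⟩, fun j hj => ⟨hN j _ ?_ ?_, trivial⟩,
      fun w => ⟨⟨(0, w), fun j _ => rfl, ?_⟩, trivial⟩⟩
    · have := h.len_pos j; omega
    · simp [hj]
    · rw [D.comb_apply]; simp
  obtain ⟨v, hv⟩ := mem_dom.1 hd
  obtain ⟨⟨c, w⟩, hc, hcw⟩ := (hA hv).1
  have hd' : D.comb (fun j i => if i = D.len j - 1 ∧ D.r j = false then d j else 0, 0) =
      ∑ j, (if D.r j then 0 else d j • D.e j (D.len j - 1)) := by
    rw [D.comb_apply, map_zero, add_zero]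
    refine Finset.sum_congr rfl fun j _ => ?_
    have := h.len_pos j
    rw [Finset.sum_eq_single_of_mem (D.len j - 1) (Finset.mem_range.2 (by omega))
      (fun i _ hi => by simp [hi])]
    cases D.r j <;> simp
  have h0 : D.comb ((fun j i => if i = D.len j - 1 ∧ D.r j = false then d j else 0, 0) - (c, w))
      = 0 := by
    rw [map_sub, hd', hcw]; exact sub_self _
  intro j hj
  have hlen := h.len_pos j
  have := (h.indep _ _ h0).1 j (D.len j - 1) (by omega)
  have hc' := hc j hj
  simp only at hc'
  simpa [hj, hc'] using this

end IsStringDecomp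

namespace StringData

/-- The string system obtained from `D` by appending the vector `y j` on the right of all strings
with `E j`, and adding strings of length one that consist of the vectors `z k`. -/
def extend (D : StringData V) (E : D.J → Bool) (y : D.J → V) {K : Type} [Fintype K] (z : K → V)
    (l' r' : K → Bool) : StringData V where
  J := D.J ⊕ K
  len := Sum.elim (fun j => D.len j + if E j then 1 else 0) (fun _ => 1)
  l := Sum.elim D.l l'
  r := Sum.elim D.r r'
  e := Sum.elim (fun j i => if i < D.len j then D.e j i else y j) (fun k _ => z k)
  m := D.m
  T := D.T
  incl := D.incl

/-- The arrows of an extended string system belong to `Q`. -/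
structure ExtendPairsIn (D : StringData V) (E : D.J → Bool) (y : D.J → V) {K : Type} (z : K → V)
    (l' r' : K → Bool) (Q : LinRel V) : Prop where
  arrow : ∀ j i, i + 1 < D.len j → (D.e j i, D.e j (i + 1)) ∈ Q
  last : ∀ j, E j = true → (D.e j (D.len j - 1), y j) ∈ Q
  left : ∀ j, D.l j = true → ((0 : V), D.e j 0) ∈ Q
  right : ∀ j, D.r j = true → E j = false → (D.e j (D.len j - 1), (0 : V)) ∈ Q
  right' : ∀ j, D.r j = true → E j = true → (y j, (0 : V)) ∈ Q
  single_left : ∀ k, l' k = true → ((0 : V), z k) ∈ Q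
  single_right : ∀ k, r' k = true → (z k, (0 : V)) ∈ Q
  unit : ∀ w, (D.incl w, D.incl (D.T w)) ∈ Q

variable {D : StringData V} {E : D.J → Bool} {y : D.J → V} {K : Type} [Fintype K] {z : K → V}
    {l' r' : K → Bool}

theorem extend_pairsIn_iff (hlen : ∀ j, 0 < D.len j) {Q : LinRel V} :
    (D.extend E y z l' r').PairsIn Q ↔ D.ExtendPairsIn E y z l' r' Q := by
  constructor
  · intro h
    refine ⟨fun j i hi => ?_, fun j hj => ?_, fun j hj => ?_, fun j hj hE => ?_, fun j hj hE => ?_,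
      fun k hk => h.left (Sum.inr k) hk, fun k hk => h.right (Sum.inr k) hk, h.unit⟩
    · have := h.arrow (Sum.inl j) i (by simp only [extend, Sum.elim_inl]; omega)
      simpa only [extend, Sum.elim_inl, show i < D.len j by omega, hi, if_true] using this
    · have hp := hlen j
      have := h.arrow (Sum.inl j) (D.len j - 1)
        (by simp only [extend, Sum.elim_inl, hj, if_true]; omega)
      simpa only [extend, Sum.elim_inl, show D.len j - 1 < D.len j by omega, if_true,
        show ¬ D.len j - 1 + 1 < D.len j by omega, if_false] using this
    · have := h.left (Sum.inl j) hj
      simpa only [extend, Sum.elim_inl, hlen j, if_true] using this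
    · have hp := hlen j
      have := h.right (Sum.inl j) hj
      simpa [extend, hE, hp] using this
    · have := h.right (Sum.inl j) hj
      simpa [extend, hE] using this
  · intro h
    refine ⟨?_, ?_, ?_, h.unit⟩
    · rintro (j | k) i hi
      · simp only [extend, Sum.elim_inl] at hi ⊢
        by_cases h1 : i + 1 < D.len j
        · rw [if_pos (by omega), if_pos h1]; exact h.arrow j i h1
        · have hE : E j = true := by
            by_contra hE
            simp only [hE] at hi
            simp at hi
            omega
          simp only [hE, if_true] at hi
          rw [if_pos (by omega), if_neg h1]
          have := h.last j hE
          rwa [show D.len j - 1 = i by omega] at this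
      · simp [extend] at hi
    · rintro (j | k) hj
      · simpa [extend, hlen j] using h.left j hj
      · exact h.single_left k hj
    · rintro (j | k) hj
      · have hp := hlen j
        by_cases hE : E j = true
        · simpa [extend, hE] using h.right' j hj hE
        · simp only [Bool.not_eq_true] at hE
          simpa [extend, hE, hp] using h.right j hj hE
      · exact h.single_right k hj

theorem extend_comb (c : D.J ⊕ K → ℕ → ℂ) (w : Fin D.m → ℂ) :
    (D.extend E y z l' r').comb (c, w) = D.comb (fun j => c (Sum.inl j), w) +
      ∑ j, (if E j then c (Sum.inl j) (D.len j) • y j else 0) + ∑ k, c (Sum.inr k) 0 • z k := by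
  have h1 : (D.extend E y z l' r').comb (c, w) = ∑ j : D.J ⊕ K,
      ∑ i ∈ Finset.range ((D.extend E y z l' r').len j), c j i • (D.extend E y z l' r').e j i +
        D.incl w := comb_apply (D.extend E y z l' r') c w
  rw [h1, D.comb_apply, Fintype.sum_sum_type]
  have h2 : ∀ j, ∑ i ∈ Finset.range ((D.extend E y z l' r').len (Sum.inl j)),
      c (Sum.inl j) i • (D.extend E y z l' r').e (Sum.inl j) i =
      ∑ i ∈ Finset.range (D.len j), c (Sum.inl j) i • D.e j i +
        (if E j then c (Sum.inl j) (D.len j) • y j else 0) := by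
    intro j
    have h3 : ∑ i ∈ Finset.range (D.len j),
        c (Sum.inl j) i • (if i < D.len j then D.e j i else y j) =
        ∑ i ∈ Finset.range (D.len j), c (Sum.inl j) i • D.e j i :=
      Finset.sum_congr rfl fun i hi => by rw [if_pos (Finset.mem_range.1 hi)]
    cases hE : E j
    · simpa [extend, hE] using h3
    · simpa [extend, hE, Finset.sum_range_succ] using h3
  have h4 : ∀ k, ∑ i ∈ Finset.range ((D.extend E y z l' r').len (Sum.inr k)),
      c (Sum.inr k) i • (D.extend E y z l' r').e (Sum.inr k) i = c (Sum.inr k) 0 • z k := by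
    intro k; simp [extend]
  simp only [h2, h4, Finset.sum_add_distrib]
  abel

theorem extend_isStringDecomp {A : LinRel V} (hlen : ∀ j, 0 < D.len j)
    (hindep : ∀ c w (d : D.J → ℂ) (f : K → ℂ),
      D.comb (c, w) + ∑ j, (if E j then d j • y j else 0) + ∑ k, f k • z k = 0 →
      (∀ j i, i < D.len j → c j i = 0) ∧ w = 0 ∧ (∀ j, E j = true → d j = 0) ∧ f = 0)
    (hspan : ∀ P : Submodule ℂ V, (∀ j i, i < D.len j → D.e j i ∈ P) → (∀ w, D.incl w ∈ P) →
      (∀ j, E j = true → y j ∈ P) → (∀ k, z k ∈ P) → P = ⊤)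
    (hpairs : D.ExtendPairsIn E y z l' r' A)
    (hgen : ∀ Q : LinRel V, D.ExtendPairsIn E y z l' r' Q → A ≤ Q) :
    IsStringDecomp A (D.extend E y z l' r') where
  len_pos := by
    rintro (j | k)
    · have := hlen j; simp only [extend, Sum.elim_inl]; omega
    · simp [extend]
  indep c w h0 := by
    have h1 := hindep (fun j => c (Sum.inl j)) w (fun j => c (Sum.inl j) (D.len j))
      (fun k => c (Sum.inr k) 0) ((extend_comb (E := E) (y := y) (z := z) (l' := l') (r' := r')
        c w).symm.trans h0)
    refine ⟨?_, h1.2.1⟩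
    rintro (j | k) i hi
    · by_cases hij : i < D.len j
      · exact h1.1 j i hij
      · cases hE : E j
        · simp [extend, hE] at hi; omega
        · simp [extend, hE] at hi
          obtain rfl : i = D.len j := by omega
          exact h1.2.2.1 j hE
    · simp [extend] at hi
      subst hi
      exact congrFun h1.2.2.2 k
  span P hP hw := by
    refine hspan P (fun j i hi => ?_) hw (fun j hj => ?_) (fun k => ?_)
    · have := hP (Sum.inl j) i (by simp only [extend, Sum.elim_inl]; omega)
      simpa [extend, hi] using this
    · have := hP (Sum.inl j) (D.len j) (by simp [extend, hj])
      simpa [extend] using this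
    · exact hP (Sum.inr k) 0 (by simp [extend])
  pairs := (extend_pairsIn_iff hlen).2 hpairs
  gen Q hQ := hgen Q ((extend_pairsIn_iff hlen).1 hQ)

end StringData

end Strings

/-! ### Existence of string decompositions -/

section Existence

universe u

variable {V : Type u} [AddCommGroup V] [Module ℂ V]

/-- A basis of `K` relative to `M`: vectors of `K` that span `K` together with `M` and are linearly
independent modulo `M`. -/
theorem exists_relative_basis [FiniteDimensional ℂ V] {M K : Submodule ℂ V} (hMK : M ≤ K) :
    ∃ (k : ℕ) (b : Fin k → V), (∀ i, b i ∈ K) ∧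
      (∀ P : Submodule ℂ V, M ≤ P → (∀ i, b i ∈ P) → K ≤ P) ∧
      (∀ f : Fin k → ℂ, ∑ i, f i • b i ∈ M → f = 0) := by
  obtain ⟨C, hC⟩ := Submodule.exists_isCompl M
  let β := Module.finBasis ℂ (C ⊓ K : Submodule ℂ V)
  refine ⟨_, fun i => (β i : V), fun i => (β i).2.2, fun P hM hb => ?_, fun f hf => ?_⟩
  · have h1 : M ⊔ C ⊓ K = K := by
      rw [← sup_inf_assoc_of_le C hMK, hC.sup_eq_top, top_inf_eq]
    rw [← h1]
    refine sup_le hM fun v hv => ?_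
    have := β.sum_repr ⟨v, hv⟩
    have h2 := congrArg (Submodule.subtype _) this
    rw [map_sum] at h2
    simp only [Submodule.subtype_apply, Submodule.coe_smul] at h2
    rw [← h2]
    exact Submodule.sum_mem _ fun i _ => P.smul_mem _ (hb i)
  · have h1 : ((∑ i, f i • β i : (C ⊓ K : Submodule ℂ V)) : V) = ∑ i, f i • (β i : V) := by
      simp
    have h2 : (∑ i, f i • β i : (C ⊓ K : Submodule ℂ V)) = 0 := by
      refine Subtype.ext ?_
      have h3 := (∑ i, f i • β i : (C ⊓ K : Submodule ℂ V)).2.1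
      rw [h1] at h3
      rw [h1]
      exact Submodule.disjoint_def.1 hC.disjoint _ hf h3
    funext i
    exact Fintype.linearIndependent_iff.1 β.linearIndependent f h2 i

/-- A relation with trivial kernel and full domain is the graph of an automorphism. -/
theorem exists_stringDecomp_of_ker_eq_bot [FiniteDimensional ℂ V] (A : LinRel V)
    (hker : ker A = ⊥) (hdom : dom A = ⊤) : ∃ D : StringData V, IsStringDecomp A D := by
  let p₁ : A →ₗ[ℂ] V := (LinearMap.fst ℂ V V).domRestrict A
  let p₂ : A →ₗ[ℂ] V := (LinearMap.snd ℂ V V).domRestrict A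
  have s₁ : Function.Surjective p₁ := fun u => by
    obtain ⟨v, hv⟩ := mem_dom.1 (show u ∈ dom A by rw [hdom]; trivial)
    exact ⟨⟨(u, v), hv⟩, rfl⟩
  have i₂ : Function.Injective p₂ := by
    rw [← LinearMap.ker_eq_bot, eq_bot_iff]
    rintro ⟨⟨u, v⟩, huv⟩ h0
    obtain rfl : v = 0 := h0
    have : u ∈ ker A := huv
    rw [hker, Submodule.mem_bot] at this
    subst this
    rfl
  have hrank : Module.finrank ℂ A = Module.finrank ℂ V :=
    le_antisymm (LinearMap.finrank_le_finrank_of_injective i₂)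
      (LinearMap.finrank_le_finrank_of_surjective s₁)
  have i₁ := (LinearMap.injective_iff_surjective_of_finrank_eq_finrank hrank).2 s₁
  have s₂ := (LinearMap.injective_iff_surjective_of_finrank_eq_finrank hrank).1 i₂
  let q₁ := LinearEquiv.ofBijective p₁ ⟨i₁, s₁⟩
  let q₂ := LinearEquiv.ofBijective p₂ ⟨i₂, s₂⟩
  let ε := (Module.finBasis ℂ V).equivFun
  refine ⟨{ J := Empty, len := Empty.elim, l := Empty.elim, r := Empty.elim, e := Empty.elim
            m := Module.finrank ℂ V, T := ε.symm ≪≫ₗ q₁.symm ≪≫ₗ q₂ ≪≫ₗ ε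
            incl := ε.symm }, fun j => j.elim, ?_, ?_, ?_, ?_⟩
  · intro c w h0
    rw [StringData.comb_apply] at h0
    refine ⟨fun j => j.elim, ?_⟩
    simpa using h0
  · intro P _ hP
    rw [eq_top_iff]
    intro v _
    simpa using hP (ε v)
  · refine ⟨fun j => j.elim, fun j => j.elim, fun j => j.elim, fun w => ?_⟩
    have h1 := (q₁.symm (ε.symm w)).2
    have h2 : (q₁.symm (ε.symm w) : V × V).1 = ε.symm w := q₁.apply_symm_apply (ε.symm w)
    have h3 : (q₁.symm (ε.symm w) : V × V) = (ε.symm w, q₂ (q₁.symm (ε.symm w))) :=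
      Prod.ext h2 rfl
    rw [h3] at h1
    simpa using h1
  · rintro Q hQ ⟨u, v⟩ huv
    have h1 := hQ.unit (ε u)
    have h2 : q₁.symm u = ⟨(u, v), huv⟩ := by
      rw [LinearEquiv.symm_apply_eq]; rfl
    simp only [LinearEquiv.trans_apply, LinearEquiv.coe_coe, LinearEquiv.symm_apply_apply,
      h2] at h1
    exact h1

/-- The step from `dom A` to `V`: strings without an arrow on the right are prolonged, and new
vectors appear as strings `0 → b` and as strings without any arrow. -/
theorem exists_stringDecomp_of_dom [FiniteDimensional ℂ V] (A : LinRel V)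
    (X : Submodule ℂ V) (hX : X = dom A) (A₁ : LinRel X)
    (hA₁ : A₁ = A.comap (X.subtype.prodMap X.subtype)) (D₁ : StringData X)
    (h₁ : IsStringDecomp A₁ D₁) : ∃ D : StringData V, IsStringDecomp A D := by
  have memA₁ : ∀ u v : X, (u, v) ∈ A₁ ↔ ((u : V), (v : V)) ∈ A := by
    subst hA₁; exact fun u v => Iff.rfl
  have hpairs : D₁.PairsIn (A.comap (X.subtype.prodMap X.subtype)) := hA₁ ▸ h₁.pairs
  let D : StringData V :=
    { J := D₁.J, len := D₁.len, l := D₁.l, r := D₁.r, e := fun j i => D₁.e j i, m := D₁.m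
      T := D₁.T, incl := X.subtype.comp D₁.incl }
  have hcomb : ∀ c w, D.comb (c, w) = (D₁.comb (c, w) : X) := by
    intro c w
    rw [D.comb_apply, D₁.comb_apply]
    simp [D]
  have hy : ∀ j, ∃ y, (D.e j (D.len j - 1), y) ∈ A := fun j =>
    mem_dom.1 (hX ▸ (D₁.e j (D₁.len j - 1)).2)
  choose y hy using hy
  obtain ⟨a, b, hbK, hbgen, hbind⟩ :=
    exists_relative_basis (inf_le_left : mul A ⊓ X ≤ mul A)
  obtain ⟨a', b', -, hbgen', hbind'⟩ :=
    exists_relative_basis (le_top : X ⊔ Submodule.span ℂ (Set.range y) ⊔ mul A ≤ ⊤)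
  refine ⟨D.extend (fun j => !D.r j) y (Sum.elim b b') (Sum.elim (fun _ => true) fun _ => false)
    (fun _ => false), StringData.extend_isStringDecomp h₁.len_pos ?_ ?_ ?_ ?_⟩
  · intro c w d f h0
    rw [Fintype.sum_sum_type] at h0
    simp only [Sum.elim_inl, Sum.elim_inr] at h0
    have hf₁ : ∑ k, f (Sum.inl k) • b k ∈ mul A :=
      Submodule.sum_mem _ fun k _ => Submodule.smul_mem _ _ (hbK k)
    have hYs : ∑ j, (if (!D.r j) then d j • y j else 0) ∈ Submodule.span ℂ (Set.range y) := by
      refine Submodule.sum_mem _ fun j _ => ?_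
      split_ifs
      · exact Submodule.smul_mem _ _ (Submodule.subset_span ⟨j, rfl⟩)
      · exact Submodule.zero_mem _
    have hC : D.comb (c, w) ∈ X := by rw [hcomb]; exact Subtype.mem _
    have hf₂ : (fun k => f (Sum.inr k)) = 0 := by
      refine hbind' _ ?_
      have : ∑ k, f (Sum.inr k) • b' k = -(D.comb (c, w) +
          ∑ j, (if (!D.r j) then d j • y j else 0) + ∑ k, f (Sum.inl k) • b k) := by
        rw [eq_neg_iff_add_eq_zero]; refine Eq.trans ?_ h0; abel
      rw [this]
      exact Submodule.neg_mem _ (Submodule.add_mem_sup (Submodule.add_mem_sup hC hYs) hf₁)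
    have hz₂ : ∑ k, f (Sum.inr k) • b' k = 0 :=
      Finset.sum_eq_zero fun k _ => by rw [show f (Sum.inr k) = 0 from congrFun hf₂ k, zero_smul]
    rw [hz₂, add_zero] at h0
    -- The vector `∑ d j (last vector of the string j)` of `dom A` has an image in `dom A`.
    -- So its coefficients vanish, by the independence of these last vectors modulo `dom A₁`.
    have hlast : ∑ j, (if D₁.r j then 0 else d j • D₁.e j (D₁.len j - 1)) ∈ dom A₁ := by
      refine mem_dom.2 ⟨-D₁.comb (c, w), (memA₁ _ _).2 ?_⟩
      have h1 : ((0 : V), ∑ k, f (Sum.inl k) • b k) ∈ A := hf₁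
      have h2 : ∑ j, (if (!D.r j) then d j • ((D.e j (D.len j - 1), y j) : V × V) else 0) ∈ A := by
        refine Submodule.sum_mem _ fun j _ => ?_
        split_ifs
        · exact Submodule.smul_mem _ _ (hy j)
        · exact Submodule.zero_mem _
      convert A.add_mem h1 h2 using 1
      refine Prod.ext ?_ ?_
      · simp only [Prod.fst_add, Prod.fst_sum, zero_add]
        rw [Submodule.coe_sum]
        refine Finset.sum_congr rfl fun j _ => ?_
        cases D₁.r j <;> simp [D]
      · simp only [Prod.snd_add, Prod.snd_sum]
        rw [Submodule.coe_neg, ← hcomb, neg_eq_iff_add_eq_zero]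
        refine Eq.trans ?_ h0
        have : ∀ j, (if (!D.r j) then d j • ((D.e j (D.len j - 1), y j) : V × V) else 0).2 =
            if (!D.r j) then d j • y j else 0 := fun j => by split_ifs <;> rfl
        simp only [this]
        abel
    have hd := h₁.last_indep d hlast
    have hz : ∑ j, (if (!D.r j) then d j • y j else 0) = 0 := by
      refine Finset.sum_eq_zero fun j _ => ?_
      split_ifs with hr
      · rw [hd j (by simpa using hr), zero_smul]
      · rfl
    rw [hz, add_zero] at h0
    have hf₃ : (fun k => f (Sum.inl k)) = 0 := by
      refine hbind _ ⟨hf₁, ?_⟩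
      rw [← neg_eq_of_add_eq_zero_right h0]
      exact Submodule.neg_mem _ hC
    have hz₃ : ∑ k, f (Sum.inl k) • b k = 0 :=
      Finset.sum_eq_zero fun k _ => by rw [show f (Sum.inl k) = 0 from congrFun hf₃ k, zero_smul]
    rw [hz₃, add_zero, hcomb] at h0
    have h4 := h₁.indep c w (Subtype.ext h0)
    refine ⟨h4.1, h4.2, fun j hj => hd j (by simpa using hj), ?_⟩
    funext k
    rcases k with k | k
    · exact congrFun hf₃ k
    · exact congrFun hf₂ k
  · intro P he hw hyP hz
    have hXP : X ≤ P := by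
      have := h₁.span (P.comap X.subtype) he hw
      intro v hv
      have h1 : (⟨v, hv⟩ : X) ∈ P.comap X.subtype := by rw [this]; trivial
      exact h1
    have hmP : mul A ≤ P := hbgen P (inf_le_right.trans hXP) fun i => hz (Sum.inl i)
    refine eq_top_iff.2 (hbgen' P (sup_le (sup_le hXP (Submodule.span_le.2 ?_)) hmP)
      fun i => hz (Sum.inr i))
    rintro _ ⟨j, rfl⟩
    cases hr : D.r j
    · exact hyP j (by simp [hr])
    · -- Here the last vector of the string lies in the kernel, and `y j` in `mul A`.
      have h1 : (D.e j (D.len j - 1), (0 : V)) ∈ A := hpairs.right j hr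
      have h2 := A.sub_mem (hy j) h1
      exact hmP (mem_mul.2 (by simpa using h2))
  · refine ⟨hpairs.arrow, fun j _ => hy j, hpairs.left, fun j hj _ => hpairs.right j hj,
      fun j hj hE => ?_, ?_, fun k hk => by simp at hk, hpairs.unit⟩
    · simp [hj] at hE
    · rintro (k | k) hk
      · exact hbK k
      · simp at hk
  · intro Q hQ
    have hA₁Q : A₁ ≤ Q.comap (X.subtype.prodMap X.subtype) := by
      refine h₁.gen _ ⟨hQ.arrow, hQ.left, fun j hj => hQ.right j hj ?_, hQ.unit⟩
      simp only [Bool.not_eq_false']; exact hj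
    have hmQ : ∀ v ∈ mul A, ((0 : V), v) ∈ Q := by
      have := hbgen (Q.comap (LinearMap.inr ℂ V V)) ?_ fun i => hQ.single_left (Sum.inl i) rfl
      · exact this
      · rintro v ⟨hv, hvX⟩
        exact hA₁Q ((memA₁ 0 ⟨v, hvX⟩).2 hv)
    -- Every vector of `dom A` has an image under `Q ⊓ A`.
    have hdomQ : X ≤ dom (Q ⊓ A) := by
      have := h₁.span ((dom (Q ⊓ A)).comap X.subtype) (fun j i hi => ?_) fun w =>
        mem_dom.2 ⟨_, hQ.unit w, hpairs.unit w⟩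
      · intro v hv
        have h1 : (⟨v, hv⟩ : X) ∈ (dom (Q ⊓ A)).comap X.subtype := by rw [this]; trivial
        exact h1
      · by_cases hi' : i + 1 < D.len j
        · exact mem_dom.2 ⟨_, hQ.arrow j i hi', hpairs.arrow j i hi'⟩
        · obtain rfl : i = D.len j - 1 := by
            have : i < D.len j := hi
            omega
          cases hr : D.r j
          · exact mem_dom.2 ⟨_, hQ.last j (by simp [hr]), hy j⟩
          · exact mem_dom.2 ⟨_, hQ.right j hr (by simp [hr]), hpairs.right j hr⟩
    rintro ⟨u, v⟩ huv
    obtain ⟨v', hvQ, hvA⟩ := mem_dom.1 (hdomQ (hX ▸ mem_dom.2 ⟨v, huv⟩))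
    have h2 : ((0 : V), v - v') ∈ A := by simpa using A.sub_mem huv hvA
    have h3 := Q.add_mem (hmQ _ (mem_mul.2 h2)) hvQ
    simpa using h3

/-- The step from `V ⧸ ker A` to `V`: strings with an arrow on the right are prolonged, and new
vectors appear as strings `0 → b → 0` and `b → 0`. -/
theorem exists_stringDecomp_of_quotient [FiniteDimensional ℂ V] (A : LinRel V)
    (K : Submodule ℂ V) (hK : K = ker A) (A₁ : LinRel (V ⧸ K))
    (hA₁ : A₁ = A.map (K.mkQ.prodMap K.mkQ)) (D₁ : StringData (V ⧸ K))
    (h₁ : IsStringDecomp A₁ D₁) : ∃ D : StringData V, IsStringDecomp A D := by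
  set π := K.mkQ with hπ
  have hπK : ∀ v, π v = 0 ↔ v ∈ K := fun v => Submodule.Quotient.mk_eq_zero K
  have hKA : ∀ v ∈ K, (v, (0 : V)) ∈ A := by
    subst hK; exact fun v hv => hv
  -- A pair of the quotient relation lifts with a prescribed lift of its first component.
  have hlift : ∀ (u : V) (v' : V ⧸ K), ∃ v, π v = v' ∧ ((π u, v') ∈ A₁ → (u, v) ∈ A) := by
    intro u v'
    by_cases h : (π u, v') ∈ A₁
    · rw [hA₁] at h
      obtain ⟨⟨a, b⟩, hab, h2⟩ := h
      obtain ⟨h3, h4⟩ := Prod.mk.inj h2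
      refine ⟨b, h4, fun _ => ?_⟩
      have h5 : u - a ∈ K := by
        rw [← hπK, map_sub, sub_eq_zero]; exact h3.symm
      have := A.add_mem hab (hKA _ h5)
      simpa using this
    · obtain ⟨v, hv⟩ := K.mkQ_surjective v'
      exact ⟨v, hv, fun h' => absurd h' h⟩
  choose g hg hgA using hlift
  let e : D₁.J → ℕ → V := fun j =>
    Nat.rec (g 0 (D₁.e j 0)) (fun i u => g u (D₁.e j (i + 1)))
  have he0 : ∀ j, e j 0 = g 0 (D₁.e j 0) := fun _ => rfl
  have heS : ∀ j i, e j (i + 1) = g (e j i) (D₁.e j (i + 1)) := fun _ _ => rfl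
  have hπe : ∀ j i, π (e j i) = D₁.e j i := by
    rintro j (_ | i)
    · rw [he0]; exact hg _ _
    · rw [heS]; exact hg _ _
  -- Lift the pairs `(incl w, incl (T w))` linearly to pairs `G w` of `A`.  The second components
  -- determine the lift of the bijective part; the first ones may be corrected by `ker A`.
  have hG : ∀ k, ∃ p : V × V, p ∈ A ∧
      π.prodMap π p = (D₁.incl.prod (D₁.incl.comp (D₁.T : _ →ₗ[ℂ] _))) (Pi.basisFun ℂ (Fin D₁.m) k) :=
    fun k => by
      have := h₁.pairs.unit (Pi.basisFun ℂ (Fin D₁.m) k)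
      rw [hA₁] at this
      exact this
  choose p hpA hpπ using hG
  let G : (Fin D₁.m → ℂ) →ₗ[ℂ] V × V := (Pi.basisFun ℂ (Fin D₁.m)).constr ℂ p
  have hGA : ∀ w, G w ∈ A := by
    intro w
    rw [Module.Basis.constr_apply_fintype]
    exact Submodule.sum_mem _ fun k _ => A.smul_mem _ (hpA k)
  have hGπ : (π.prodMap π).comp G = D₁.incl.prod (D₁.incl.comp (D₁.T : _ →ₗ[ℂ] _)) := by
    refine (Pi.basisFun ℂ (Fin D₁.m)).ext fun k => ?_
    rw [LinearMap.comp_apply, Module.Basis.constr_basis, hpπ]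
  have hG1 : ∀ w, π (G w).1 = D₁.incl w := fun w =>
    congrArg Prod.fst (LinearMap.congr_fun hGπ w)
  have hG2 : ∀ w, π (G w).2 = D₁.incl (D₁.T w) := fun w =>
    congrArg Prod.snd (LinearMap.congr_fun hGπ w)
  let D : StringData V :=
    { J := D₁.J, len := D₁.len, l := D₁.l, r := D₁.r, e := e, m := D₁.m, T := D₁.T
      incl := ((LinearMap.snd ℂ V V).comp G).comp (D₁.T.symm : _ →ₗ[ℂ] _) }
  have hincl : ∀ w, D.incl w = (G (D₁.T.symm w)).2 := fun _ => rfl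
  have hπincl : ∀ w, π (D.incl w) = D₁.incl w := by
    intro w; rw [hincl, hG2, LinearEquiv.apply_symm_apply]
  have hunit : ∀ w, (D.incl w, D.incl (D.T w)) ∈ A := by
    intro w
    have h1 : D.incl w - (G w).1 ∈ K := by rw [← hπK, map_sub, hπincl, hG1, sub_self]
    have h2 := A.add_mem (hGA w) (hKA _ h1)
    have h3 : D.incl (D.T w) = (G w).2 := by
      rw [hincl]; exact congrArg (fun t => (G t).2) (D₁.T.symm_apply_apply w)
    rw [h3]
    convert h2 using 1
    refine Prod.ext ?_ ?_ <;> simp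
  have hπcomb : ∀ c w, π (D.comb (c, w)) = D₁.comb (c, w) := by
    intro c w
    rw [D.comb_apply, D₁.comb_apply, map_add, map_sum, hπincl]
    congr 1
    refine Finset.sum_congr rfl fun j _ => ?_
    rw [map_sum]
    refine Finset.sum_congr rfl fun i _ => ?_
    rw [map_smul]
    exact congrArg _ (hπe j i)
  let y : D.J → V := fun j => g (e j (D₁.len j - 1)) 0
  have hyK : ∀ j, y j ∈ K := fun j => (hπK _).1 (hg _ _)
  have harrow : ∀ j i, i + 1 < D.len j → (D.e j i, D.e j (i + 1)) ∈ A := by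
    intro j i hi
    refine hgA _ _ ?_
    rw [hπe]
    exact h₁.pairs.arrow j i hi
  have hleft : ∀ j, D.l j = true → ((0 : V), D.e j 0) ∈ A := by
    intro j hj
    refine hgA _ _ ?_
    rw [map_zero]
    exact h₁.pairs.left j hj
  have hlast : ∀ j, D.r j = true → (D.e j (D.len j - 1), y j) ∈ A := by
    intro j hj
    refine hgA _ _ ?_
    rw [hπe]
    exact h₁.pairs.right j hj
  obtain ⟨a, b, hbK, hbgen, hbind⟩ :=
    exists_relative_basis (bot_le : ⊥ ≤ K ⊓ mul A)
  have hYK : Submodule.span ℂ (Set.range fun j : {j : D.J // D.r j = true} => y j) ≤ K :=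
    Submodule.span_le.2 (by rintro _ ⟨j, rfl⟩; exact hyK j)
  obtain ⟨a', b', hbK', hbgen', hbind'⟩ := exists_relative_basis
    (sup_le hYK inf_le_left :
      Submodule.span ℂ (Set.range fun j : {j : D.J // D.r j = true} => y j) ⊔ K ⊓ mul A ≤ K)
  refine ⟨D.extend D.r y (Sum.elim b b') (Sum.elim (fun _ => true) fun _ => false)
    (fun _ => true), StringData.extend_isStringDecomp h₁.len_pos ?_ ?_ ?_ ?_⟩
  · intro c w d f h0
    rw [Fintype.sum_sum_type] at h0
    simp only [Sum.elim_inl, Sum.elim_inr] at h0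
    have hf₁ : ∑ k, f (Sum.inl k) • b k ∈ K ⊓ mul A :=
      Submodule.sum_mem _ fun k _ => Submodule.smul_mem _ _ (hbK k)
    have hf₂ : ∑ k, f (Sum.inr k) • b' k ∈ K :=
      Submodule.sum_mem _ fun k _ => Submodule.smul_mem _ _ (hbK' k)
    have hYs : ∑ j, (if D.r j then d j • y j else 0) ∈
        Submodule.span ℂ (Set.range fun j : {j : D.J // D.r j = true} => y j) := by
      refine Submodule.sum_mem _ fun j _ => ?_
      split_ifs with hr
      · exact Submodule.smul_mem _ _ (Submodule.subset_span ⟨⟨j, hr⟩, rfl⟩)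
      · exact Submodule.zero_mem _
    have hc := h₁.indep c w (by
      have h1 := congrArg π h0
      rwa [map_add, map_add, map_add, (hπK _).2 (hYK hYs), (hπK _).2 hf₁.1, (hπK _).2 hf₂,
        map_zero, add_zero, add_zero, add_zero, hπcomb] at h1)
    have hz : D.comb (c, w) = 0 := by
      rw [D.comb_apply, hc.2, map_zero, add_zero]
      refine Finset.sum_eq_zero fun j _ => Finset.sum_eq_zero fun i hi => ?_
      rw [hc.1 j i (Finset.mem_range.1 hi), zero_smul]
    rw [hz, zero_add] at h0
    have hf₃ : (fun k => f (Sum.inr k)) = 0 := by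
      refine hbind' _ ?_
      have : ∑ k, f (Sum.inr k) • b' k = -(
          ∑ j, (if D.r j then d j • y j else 0) + ∑ k, f (Sum.inl k) • b k) := by
        rw [eq_neg_iff_add_eq_zero]; refine Eq.trans ?_ h0; abel
      rw [this]
      exact Submodule.neg_mem _ (Submodule.add_mem_sup hYs hf₁)
    have hz₃ : ∑ k, f (Sum.inr k) • b' k = 0 :=
      Finset.sum_eq_zero fun k _ => by rw [show f (Sum.inr k) = 0 from congrFun hf₃ k, zero_smul]
    rw [hz₃, add_zero] at h0
    -- The combination of last vectors over the appended vectors lies in `ker A`, so that it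
    -- vanishes in the quotient.
    have hker : ∑ j, (if D.r j then d j • D.e j (D.len j - 1) else 0) ∈ K := by
      have h1 : ((0 : V), ∑ k, f (Sum.inl k) • b k) ∈ A := hf₁.2
      have h2 : ∑ j, (if D.r j then d j • ((D.e j (D.len j - 1), y j) : V × V) else 0) ∈ A := by
        refine Submodule.sum_mem _ fun j _ => ?_
        split_ifs with hr
        · exact Submodule.smul_mem _ _ (hlast j hr)
        · exact Submodule.zero_mem _
      have h3 := A.add_mem h2 h1
      rw [hK, mem_ker]
      convert h3 using 1
      refine Prod.ext ?_ ?_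
      · simp only [Prod.fst_add, Prod.fst_sum, add_zero]
        refine Finset.sum_congr rfl fun j _ => ?_
        split_ifs <;> rfl
      · simp only [Prod.snd_add, Prod.snd_sum]
        refine h0.symm.trans ?_
        congr 1
        refine Finset.sum_congr rfl fun j _ => ?_
        split_ifs <;> rfl
    have hd : ∀ j, D.r j = true → d j = 0 := by
      have h1 : D₁.comb (fun j i => if i = D₁.len j - 1 ∧ D₁.r j = true then d j else 0, 0) = 0 := by
        rw [← (hπK _).2 hker, map_sum, D₁.comb_apply, map_zero, add_zero]
        refine Finset.sum_congr rfl fun j _ => ?_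
        have := h₁.len_pos j
        rw [Finset.sum_eq_single_of_mem (D₁.len j - 1) (Finset.mem_range.2 (by omega))
          (fun i _ hi => by simp [hi])]
        have h2 : π (D.e j (D.len j - 1)) = D₁.e j (D₁.len j - 1) := hπe _ _
        by_cases hr : D.r j = true
        · rw [if_pos ⟨rfl, hr⟩, if_pos hr, map_smul, h2]
        · rw [if_neg fun h => hr h.2, if_neg hr, map_zero, zero_smul]
      intro j hj
      have hlen := h₁.len_pos j
      have h3 := (h₁.indep _ _ h1).1 j (D₁.len j - 1) (by omega)
      simpa [show D₁.r j = true from hj] using h3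
    have hz₂ : ∑ j, (if D.r j then d j • y j else 0) = 0 := by
      refine Finset.sum_eq_zero fun j _ => ?_
      split_ifs with hr
      · rw [hd j hr, zero_smul]
      · rfl
    rw [hz₂, zero_add] at h0
    have hf₄ := hbind (fun k => f (Sum.inl k)) (by rw [h0]; exact Submodule.zero_mem _)
    refine ⟨hc.1, hc.2, hd, ?_⟩
    funext k
    rcases k with k | k
    · exact congrFun hf₄ k
    · exact congrFun hf₃ k
  · intro P he hw hyP hz
    have hKP : K ≤ P := hbgen' P (sup_le (Submodule.span_le.2 (by
      rintro _ ⟨j, rfl⟩; exact hyP j j.2)) (hbgen P bot_le fun i => hz (Sum.inl i)))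
      fun i => hz (Sum.inr i)
    have h1 := h₁.span (P.map π) (fun j i hi => ⟨_, he j i hi, hπe j i⟩)
      fun w => ⟨_, hw w, hπincl w⟩
    rw [eq_top_iff]
    intro v _
    obtain ⟨v', hv', hvv⟩ : π v ∈ P.map π := by rw [h1]; trivial
    have h2 : v - v' ∈ K := by rw [← hπK, map_sub, hvv, sub_self]
    have h3 := P.add_mem (hKP h2) hv'
    simpa using h3
  · refine ⟨harrow, hlast, hleft, fun j hj hE => ?_, fun j _ _ => hKA _ (hyK j), ?_, ?_, hunit⟩
    · rw [hj] at hE; cases hE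
    · rintro (k | k) hk
      · exact (hbK k).2
      · simp at hk
    · rintro (k | k) -
      · exact hKA _ (hbK k).1
      · exact hKA _ (hbK' k)
  · intro Q hQ
    have hKQ : ∀ v ∈ K, (v, (0 : V)) ∈ Q := by
      have := hbgen' (Q.comap (LinearMap.inl ℂ V V)) (sup_le (Submodule.span_le.2 (by
        rintro _ ⟨j, rfl⟩; exact hQ.right' j j.2 j.2))
        (hbgen _ bot_le fun i => hQ.single_right (Sum.inl i) rfl))
        fun i => hQ.single_right (Sum.inr i) rfl
      exact this
    have hMQ : ∀ v ∈ K ⊓ mul A, ((0 : V), v) ∈ Q :=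
      hbgen (Q.comap (LinearMap.inr ℂ V V)) bot_le fun i => hQ.single_left (Sum.inl i) rfl
    have hA₁Q : A₁ ≤ (Q ⊓ A).map (π.prodMap π) := by
      refine h₁.gen _ ⟨fun j i hi => ⟨_, ⟨hQ.arrow j i hi, harrow j i hi⟩, ?_⟩,
        fun j hj => ⟨_, ⟨hQ.left j hj, hleft j hj⟩, ?_⟩,
        fun j hj => ⟨_, ⟨hQ.last j hj, hlast j hj⟩, ?_⟩,
        fun w => ⟨_, ⟨hQ.unit w, hunit w⟩, ?_⟩⟩
      · exact Prod.ext (hπe j i) (hπe j (i + 1))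
      · exact Prod.ext (map_zero π) (hπe j 0)
      · exact Prod.ext (hπe _ _) ((hπK _).2 (hyK j))
      · exact Prod.ext (hπincl _) (hπincl _)
    rintro ⟨u, v⟩ huv
    obtain ⟨⟨u', v'⟩, ⟨hQ', hA'⟩, h2⟩ := hA₁Q
      (show (π u, π v) ∈ A₁ by rw [hA₁]; exact ⟨(u, v), huv, rfl⟩)
    obtain ⟨h3, h4⟩ := Prod.mk.inj h2
    have h5 : u - u' ∈ K := by rw [← hπK, map_sub, sub_eq_zero]; exact h3.symm
    have h6 : v - v' ∈ K := by rw [← hπK, map_sub, sub_eq_zero]; exact h4.symm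
    have h7 := A.sub_mem (A.sub_mem huv hA') (hKA _ h5)
    have h8 : v - v' ∈ mul A := mem_mul.2 (by simpa using h7)
    have h9 := Q.add_mem (Q.add_mem hQ' (hKQ _ h5)) (hMQ _ ⟨h6, h8⟩)
    simpa using h9

theorem exists_stringDecomp [FiniteDimensional ℂ V] (A : LinRel V) :
    ∃ D : StringData V, IsStringDecomp A D := by
  induction hn : Module.finrank ℂ V using Nat.strong_induction_on generalizing V with
  | _ n ih =>
    by_cases hker : ker A = ⊥
    · by_cases hdom : dom A = ⊤
      · exact exists_stringDecomp_of_ker_eq_bot A hker hdom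
      · obtain ⟨D₁, h₁⟩ := ih _ (hn ▸ Submodule.finrank_lt hdom)
          (A.comap ((dom A).subtype.prodMap (dom A).subtype)) rfl
        exact exists_stringDecomp_of_dom A _ rfl _ rfl D₁ h₁
    · have hlt : Module.finrank ℂ (V ⧸ ker A) < n := by
        have h1 := Submodule.finrank_quotient_add_finrank (ker A)
        have h2 : 0 < Module.finrank ℂ (ker A) :=
          Nat.pos_of_ne_zero fun h0 => hker (Submodule.finrank_eq_zero.1 h0)
        omega
      obtain ⟨D₁, h₁⟩ := ih _ hlt (A.map ((ker A).mkQ.prodMap (ker A).mkQ)) rfl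
      exact exists_stringDecomp_of_quotient A _ rfl _ rfl D₁ h₁

end Existence

/-! ### Jordan chains of an operator -/

section Jordan

theorem sum_elim_comb {V W : Type*} [AddCommGroup V] [Module ℂ V] [AddCommGroup W] [Module ℂ W]
    {J K : Type*} [Fintype J] [Fintype K] (len : J → ℕ) (len' : K → ℕ) (e : J → ℕ → V)
    (e' : K → ℕ → W) (g : W →ₗ[ℂ] V) (c : J ⊕ K → ℕ → ℂ) :
    ∑ j : J ⊕ K, ∑ i ∈ Finset.range (Sum.elim len len' j),
      c j i • (Sum.elim e (fun k i => g (e' k i)) j i : V) =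
    ∑ j, ∑ i ∈ Finset.range (len j), c (Sum.inl j) i • e j i +
      g (∑ k, ∑ i ∈ Finset.range (len' k), c (Sum.inr k) i • e' k i) := by
  simp [Fintype.sum_sum_type, map_sum]

/-- A Jordan basis of an operator, written from the generator of each chain down to its
eigenvector. -/
theorem exists_jordan_basis {W : Type} [AddCommGroup W] [Module ℂ W] [FiniteDimensional ℂ W]
    (f : Module.End ℂ W) : ∃ (J : Type) (_ : Fintype J) (len : J → ℕ) (μ : J → ℂ) (e : J → ℕ → W),
      (∀ j, 0 < len j) ∧
      (∀ c : J → ℕ → ℂ, ∑ j, ∑ i ∈ Finset.range (len j), c j i • e j i = 0 →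
        ∀ j i, i < len j → c j i = 0) ∧
      (∀ P : Submodule ℂ W, (∀ j i, i < len j → e j i ∈ P) → P = ⊤) ∧
      (∀ j i, i + 1 < len j → f (e j i) = e j (i + 1) + μ j • e j i) ∧
      (∀ j, f (e j (len j - 1)) = μ j • e j (len j - 1)) := by
  induction hn : Module.finrank ℂ W using Nat.strong_induction_on generalizing W with
  | _ n ih =>
    rcases subsingleton_or_nontrivial W with hW | hW
    · exact ⟨Empty, inferInstance, Empty.elim, Empty.elim, Empty.elim, fun j => j.elim,
        fun _ _ j => j.elim, fun P _ => Subsingleton.elim _ _, fun j => j.elim, fun j => j.elim⟩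
    obtain ⟨z, hz⟩ := Module.End.exists_eigenvalue f
    obtain ⟨v, hv⟩ := hz.exists_hasEigenvector
    let g : Module.End ℂ W := f - z • LinearMap.id
    obtain ⟨D, h⟩ := exists_stringDecomp (V := W) (LinearMap.graph g)
    have hfg : ∀ w, f w = g w + z • w := fun w => by simp [g]
    -- A graph has no multivalued part and full domain, so every string ends in `0` on the right
    -- only.
    have hl : ∀ j, D.l j = false := by
      intro j
      by_contra hj
      have h1 := h.pairs.left j (by simpa using hj)
      rw [LinearMap.mem_graph_iff] at h1
      exact h.e_ne_zero (h.len_pos j) (by simpa using h1)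
    have hr : ∀ j, D.r j = true := by
      classical
      intro j
      by_contra hj
      have h1 := h.last_indep (fun j' => if j' = j then 1 else 0)
        (mem_dom.2 ⟨g _, (LinearMap.mem_graph_iff g _).2 rfl⟩) j (by simpa using hj)
      simp at h1
    have hm : D.m < n := by
      have hinj : Function.Injective D.incl := by
        rw [← LinearMap.ker_eq_bot, eq_bot_iff]
        intro w hw
        refine (h.indep 0 w ?_).2
        rw [D.comb_apply, LinearMap.mem_ker.1 hw]
        simp
      have hle := LinearMap.finrank_le_finrank_of_injective hinj
      rw [Module.finrank_fin_fun, hn] at hle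
      refine lt_of_le_of_ne hle fun heq => ?_
      -- If the bijective part were everything, then `f - z` would be injective.
      have hsurj : Function.Surjective D.incl :=
        (LinearMap.injective_iff_surjective_of_finrank_eq_finrank
          (by rw [Module.finrank_fin_fun, hn, heq])).1 hinj
      obtain ⟨w, hw⟩ := hsurj v
      have h1 := (LinearMap.mem_graph_iff g _).1 (h.pairs.unit w)
      simp only at h1
      have h2 : g v = 0 := by
        have := hv.apply_eq_smul
        rw [hfg, add_eq_right] at this
        exact this
      rw [hw, h2] at h1
      have h3 : D.T w = 0 := hinj (by rw [h1, map_zero])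
      have h4 : w = 0 := by simpa using h3
      exact hv.2 (by rw [← hw, h4, map_zero])
    obtain ⟨J, _, len, μ, e, e1, e2, e3, e4, e5⟩ :=
      ih D.m hm (W := Fin D.m → ℂ) ((D.T : (Fin D.m → ℂ) →ₗ[ℂ] _) + z • LinearMap.id)
        (Module.finrank_fin_fun ℂ)
    have hι : ∀ w, f (D.incl w) =
        D.incl (((D.T : (Fin D.m → ℂ) →ₗ[ℂ] _) + z • LinearMap.id : Module.End ℂ _) w) := by
      intro w
      have h1 := (LinearMap.mem_graph_iff g _).1 (h.pairs.unit w)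
      simp only at h1
      rw [hfg, ← h1]
      simp
    refine ⟨D.J ⊕ J, inferInstance, Sum.elim D.len len, Sum.elim (fun _ => z) μ,
      Sum.elim D.e (fun k i => D.incl (e k i)), ?_, ?_, ?_, ?_, ?_⟩
    · rintro (j | k)
      · exact h.len_pos j
      · exact e1 k
    · intro c hc
      rw [sum_elim_comb] at hc
      have h1 := h.indep (fun j => c (Sum.inl j))
        (∑ k, ∑ i ∈ Finset.range (len k), c (Sum.inr k) i • e k i)
        (by rw [D.comb_apply]; exact hc)
      have h2 := e2 (fun k => c (Sum.inr k)) h1.2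
      rintro (j | k) i hi
      · exact h1.1 j i hi
      · exact h2 k i hi
    · intro P hP
      refine h.span P (fun j i hi => hP (Sum.inl j) i hi) fun w => ?_
      have h1 := e3 (P.comap D.incl) fun k i hi => hP (Sum.inr k) i hi
      have h2 : w ∈ P.comap D.incl := by rw [h1]; trivial
      exact h2
    · rintro (j | k) i hi
      · have h1 := (LinearMap.mem_graph_iff g _).1 (h.pairs.arrow j i hi)
        simp only [Sum.elim_inl] at h1 ⊢
        rw [hfg, h1]
      · simp only [Sum.elim_inr]
        rw [hι, e4 k i hi, map_add, map_smul]
    · rintro (j | k)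
      · have h1 := (LinearMap.mem_graph_iff g _).1 (h.pairs.right j (hr j))
        simp only [Sum.elim_inl] at h1 ⊢
        rw [hfg, ← h1, zero_add]
      · simp only [Sum.elim_inr]
        rw [hι, e5 k, map_smul]

end Jordan

/-! ### From strings to chains -/

section Conversion

variable {H : Type*} [AddCommGroup H] [Module ℂ H]

/-- A string of length `n` as a chain numbered from `1` and extended by zero, in the same or in
the reverse order. -/
def chainOfString (n : ℕ) (rev : Bool) (e : ℕ → H) (k : ℕ) : H :=
  if 1 ≤ k ∧ k ≤ n then e (if rev then n - k else k - 1) else 0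

/-- The type of a string with the given arrows at its two ends. -/
def kindOfEnds : Bool → Bool → PartKind
  | true, true => .singular
  | false, true => .finite 0
  | true, false => .infinite
  | false, false => .shift

/-- The pairs of the chain made of a string are the arrows of the string; strings with an arrow on
the right are reversed. -/
theorem chainPairs_subset_iff {n : ℕ} (hn : 0 < n) (l r : Bool) (e : ℕ → H) (Q : LinRel H) :
    (∀ p ∈ chainPairs n (chainOfString n r e) (kindOfEnds l r), p ∈ Q) ↔
      (∀ i, i + 1 < n → (e i, e (i + 1)) ∈ Q) ∧ (l = true → ((0 : H), e 0) ∈ Q) ∧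
      (r = true → (e (n - 1), (0 : H)) ∈ Q) := by
  have hrev : ∀ i, i < n → chainOfString n true e (n - i) = e i := fun i hi => by
    rw [chainOfString, if_pos (by omega), if_pos rfl]; congr 1; omega
  have hfwd : ∀ i, i < n → chainOfString n false e (i + 1) = e i := fun i hi => by
    rw [chainOfString, if_pos (by omega), if_neg (by simp)]; congr 1
  have h0 : ∀ r, chainOfString n r e 0 = 0 := fun r => by rw [chainOfString, if_neg (by omega)]
  have hlast : ∀ r, chainOfString n r e (n + 1) = 0 := fun r => by
    rw [chainOfString, if_neg (by omega)]
  cases r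
  · have harrow : ∀ i, i + 1 < n → (chainOfString n false e (i + 1),
        chainOfString n false e (i + 1 + 1)) = (e i, e (i + 1)) := fun i hi => by
      rw [hfwd i (by omega), hfwd (i + 1) hi]
    cases l
    · constructor
      · intro h
        refine ⟨fun i hi => ?_, by simp, by simp⟩
        rw [← harrow i hi]
        exact h _ ⟨i + 1, by omega, by omega, rfl⟩
      · rintro ⟨h, -, -⟩ _ ⟨k, h1, h2, rfl⟩
        obtain ⟨i, rfl⟩ : ∃ i, k = i + 1 := ⟨k - 1, by omega⟩
        rw [harrow i h2]
        exact h i h2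
    · constructor
      · intro h
        refine ⟨fun i hi => ?_, fun _ => ?_, by simp⟩
        · rw [← harrow i hi]
          exact h _ ⟨i + 1, by omega, rfl⟩
        · have := h _ ⟨0, hn, rfl⟩
          rwa [h0, hfwd 0 hn] at this
      · rintro ⟨h, hl, -⟩ _ ⟨k, h2, rfl⟩
        rcases k with _ | i
        · rw [h0, hfwd 0 hn]; exact hl rfl
        · rw [harrow i h2]
          exact h i h2
  · have harrow : ∀ i, i + 1 < n → (chainOfString n true e (n - (i + 1) + 1),
        chainOfString n true e (n - (i + 1))) = (e i, e (i + 1)) := fun i hi => by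
      rw [show n - (i + 1) + 1 = n - i by omega, hrev i (by omega), hrev (i + 1) hi]
    have hend : (chainOfString n true e (0 + 1), chainOfString n true e 0) = (e (n - 1), (0 : H)) := by
      rw [h0, ← hrev (n - 1) (by omega), show n - (n - 1) = 0 + 1 by omega]
    cases l
    · constructor
      · intro h
        refine ⟨fun i hi => ?_, by simp, fun _ => ?_⟩
        · have := h _ ⟨n - (i + 1), by omega, rfl⟩
          rwa [zero_smul, add_zero, harrow i hi] at this
        · have := h _ ⟨0, hn, rfl⟩
          rwa [zero_smul, add_zero, hend] at this
      · rintro ⟨h, -, hr⟩ _ ⟨k, h2, rfl⟩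
        rw [zero_smul, add_zero]
        rcases k with _ | k
        · rw [hend]; exact hr rfl
        · obtain ⟨i, rfl⟩ : ∃ i, n = i + 1 + (k + 1) := ⟨n - (k + 1) - 1, by omega⟩
          have := harrow i (by omega)
          rw [show i + 1 + (k + 1) - (i + 1) = k + 1 by omega] at this
          rw [this]
          exact h i (by omega)
    · have hbeg : (chainOfString n true e (n + 1), chainOfString n true e n) = ((0 : H), e 0) := by
        rw [hlast, ← hrev 0 hn, Nat.sub_zero]
      constructor
      · intro h
        refine ⟨fun i hi => ?_, fun _ => ?_, fun _ => ?_⟩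
        · rw [← harrow i hi]
          exact h _ ⟨n - (i + 1), by omega, rfl⟩
        · rw [← hbeg]
          exact h _ ⟨n, le_rfl, rfl⟩
        · rw [← hend]
          exact h _ ⟨0, by omega, rfl⟩
      · rintro ⟨h, hl, hr⟩ _ ⟨k, h2, rfl⟩
        rcases k with _ | k
        · rw [hend]; exact hr rfl
        · rcases h2.eq_or_lt with h3 | h3
          · rw [h3, hbeg]; exact hl rfl
          · obtain ⟨i, rfl⟩ : ∃ i, n = i + 1 + (k + 1) := ⟨n - (k + 1) - 1, by omega⟩
            have := harrow i (by omega)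
            rw [show i + 1 + (k + 1) - (i + 1) = k + 1 by omega] at this
            rw [this]
            exact h i (by omega)

/-- The analogue of `chainPairs_subset_iff` for a Jordan chain at `z`, obtained by translation to
`0`. -/
theorem chainPairs_finite_subset_iff {n : ℕ} (hn : 0 < n) (z : ℂ) (e : ℕ → H) (Q : LinRel H) :
    (∀ p ∈ chainPairs n (chainOfString n true e) (.finite z), p ∈ Q) ↔
      (∀ i, i + 1 < n → (e i, e (i + 1) + z • e i) ∈ Q) ∧ (e (n - 1), z • e (n - 1)) ∈ Q := by
  have h := chainPairs_subset_iff hn false true e (subScalar Q z)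
  constructor
  · intro h1
    have h2 := h.1 (by
      rintro _ ⟨k, hk, rfl⟩
      rw [mem_subScalar, zero_smul, add_zero]
      exact h1 _ ⟨k, hk, rfl⟩)
    refine ⟨fun i hi => mem_subScalar.1 (h2.1 i hi), ?_⟩
    simpa using mem_subScalar.1 (h2.2.2 rfl)
  · rintro ⟨h1, h2⟩
    have h3 := h.2 ⟨fun i hi => mem_subScalar.2 (h1 i hi), by simp,
      fun _ => mem_subScalar.2 (by simpa using h2)⟩
    rintro _ ⟨k, hk, rfl⟩
    have h4 := h3 _ ⟨k, hk, rfl⟩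
    rwa [mem_subScalar, zero_smul, add_zero] at h4

/-- A finite family of strings with independent vectors and spanning pairs yields a chain
decomposition; shift chains of length one, which have no pairs, are excluded. -/
theorem exists_isChainDecomp_of_family {A : LinRel H} {J : Type} [Finite J] (kind : J → PartKind)
    (len : J → ℕ) (rev : J → Bool) (e : J → ℕ → H) (hlen : ∀ j, 0 < len j)
    (hshift : ∀ j, kind j = .shift → 1 < len j)
    (hindep : LinearIndependent ℂ (fun p : Σ j, Fin (len j) => e p.1 p.2))
    (hpairs : ∀ j, ∀ p ∈ chainPairs (len j) (chainOfString (len j) (rev j) (e j)) (kind j), p ∈ A)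
    (hgen : ∀ Q : LinRel H, (∀ j, ∀ p ∈ chainPairs (len j)
      (chainOfString (len j) (rev j) (e j)) (kind j), p ∈ Q) → A ≤ Q) :
    ∃ (s : ChainShape) (x : s.Index → H), IsChainDecomp A s x := by
  obtain ⟨n, ⟨σ⟩⟩ := Finite.exists_equiv_fin J
  let s : ChainShape := ⟨n, fun j => kind (σ.symm j), fun j => len (σ.symm j), fun j => hlen _⟩
  let x : s.Index → H := fun p =>
    chainOfString (len (σ.symm p.1)) (rev (σ.symm p.1)) (e (σ.symm p.1)) (p.2 + 1)
  have hentry : ∀ j, entry s x j =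
      chainOfString (len (σ.symm j)) (rev (σ.symm j)) (e (σ.symm j)) := by
    intro j
    funext k
    by_cases hk : 1 ≤ k ∧ k ≤ s.len j
    · rw [entry, dif_pos hk]
      simp only [x]
      rw [Nat.sub_add_cancel hk.1]
    · rw [entry, dif_neg hk, chainOfString, if_neg hk]
  have hle : ∀ κ, chainRel s x κ ≤ A := fun κ => chainRel_le fun j hj p hp => by
    subst hj
    rw [hentry] at hp
    exact hpairs (σ.symm j) p hp
  refine ⟨s, x, ?_, ?_, le_antisymm (hgen _ fun j p hp => ?_) (iSup_le hle)⟩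
  · let φ : s.Index → Σ j, Fin (len j) := fun p =>
      ⟨σ.symm p.1, if rev (σ.symm p.1) then Fin.rev p.2 else p.2⟩
    have hφ : Function.Injective φ := by
      rintro ⟨j, i⟩ ⟨j', i'⟩ h
      obtain ⟨h1, h2⟩ := Sigma.mk.inj h
      obtain rfl := σ.symm.injective h1
      have h3 := eq_of_heq h2
      simp only at h3
      split_ifs at h3 with hr
      · rw [Fin.rev_injective h3]
      · rw [h3]
    have hx : x = (fun p : Σ j, Fin (len j) => e p.1 p.2) ∘ φ := by
      funext p
      have := p.2.2
      have hp : (p.2 : ℕ) + 1 ≤ len (σ.symm p.1) := this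
      simp only [x, φ, Function.comp_apply, chainOfString]
      rw [if_pos ⟨by omega, hp⟩]
      split_ifs
      · rw [Fin.val_rev]
      · rfl
    rw [hx]
    exact hindep.comp φ hφ
  · rw [iSup_chainSpace]
    refine le_antisymm (posSpan_le fun j k _ h1 h2 => ?_) ?_
    · have hmem : ∀ p ∈ chainPairs (s.len j) (entry s x j) (s.kind j), p ∈ A := fun p hp =>
        hle _ (mem_chainRel rfl hp)
      have hl : ∀ {u v : H}, (u, v) ∈ A → u ∈ support A := fun h =>
        Submodule.mem_sup_left (mem_dom.2 ⟨_, h⟩)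
      have hr : ∀ {u v : H}, (u, v) ∈ A → v ∈ support A := fun h =>
        Submodule.mem_sup_right (mem_ran.2 ⟨_, h⟩)
      have hs := hshift (σ.symm j)
      rcases hk : s.kind j with _ | z | _ | _ <;> rw [hk] at hmem
      · exact hr (hmem _ ⟨k, h2, rfl⟩)
      · obtain ⟨i, rfl⟩ : ∃ i, k = i + 1 := ⟨k - 1, by omega⟩
        exact hl (hmem _ ⟨i, by omega, rfl⟩)
      · obtain ⟨i, rfl⟩ : ∃ i, k = i + 1 := ⟨k - 1, by omega⟩
        exact hr (hmem _ ⟨i, by omega, rfl⟩)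
      · rcases h2.eq_or_lt with h3 | h3
        · have h4 : 1 < s.len j := hs hk
          obtain ⟨i, rfl⟩ : ∃ i, k = i + 1 := ⟨k - 1, by omega⟩
          exact hr (hmem _ ⟨i, by omega, by omega, rfl⟩)
        · exact hl (hmem _ ⟨k, h1, h3, rfl⟩)
    · have hA : A ≤ (posSpan s x fun _ _ => True).prod (posSpan s x fun _ _ => True) := by
        refine hgen _ fun j p hp => ?_
        have h1 : p ∈ chainPairs (s.len (σ j)) (entry s x (σ j)) (s.kind (σ j)) := by
          rw [hentry]; simpa [s] using hp
        have h2 := chainRel_le_prod _ (mem_chainRel rfl h1)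
        have h3 : chainSpace s x (s.kind (σ j)) ≤ posSpan s x fun _ _ => True := by
          rw [chainSpace_eq_posSpan]; exact posSpan_mono fun _ _ _ => trivial
        exact ⟨h3 h2.1, h3 h2.2⟩
      refine sup_le (fun u hu => ?_) fun v hv => ?_
      · obtain ⟨v, hv⟩ := mem_dom.1 hu
        exact (hA hv).1
      · obtain ⟨u, hu⟩ := mem_ran.1 hv
        exact (hA hu).2
  · refine Submodule.mem_iSup_of_mem (kind j) (mem_chainRel (j := σ j) ?_ ?_)
    · simp [s]
    · rw [hentry]; simpa [s] using hp

theorem linearIndependent_sigma {J : Type} [Fintype J] {len : J → ℕ} {e : J → ℕ → H}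
    (h : ∀ c : J → ℕ → ℂ, ∑ j, ∑ i ∈ Finset.range (len j), c j i • e j i = 0 →
        ∀ j i, i < len j → c j i = 0) :
    LinearIndependent ℂ (fun p : Σ j, Fin (len j) => e p.1 p.2) := by
  rw [Fintype.linearIndependent_iff]
  rintro c hc ⟨j, i⟩
  have h1 := h (fun j i => if hi : i < len j then c ⟨j, ⟨i, hi⟩⟩ else 0) ?_ j i i.2
  · simpa using h1
  · rw [← hc, Fintype.sum_sigma]
    refine Finset.sum_congr rfl fun j _ => ?_
    rw [Finset.sum_range]
    exact Finset.sum_congr rfl fun i _ => by simp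

/-- Every linear relation in a finite-dimensional space has a chain decomposition. -/
theorem exists_isChainDecomp [FiniteDimensional ℂ H] (A : LinRel H) :
    ∃ (s : ChainShape) (x : s.Index → H), IsChainDecomp A s x := by
  obtain ⟨D, h⟩ := exists_stringDecomp A
  obtain ⟨J, _, len, μ, e, e1, e2, e3, e4, e5⟩ :=
    exists_jordan_basis (D.T : (Fin D.m → ℂ) →ₗ[ℂ] _)
  let len' : D.J ⊕ J → ℕ := Sum.elim D.len len
  let kind' : D.J ⊕ J → PartKind := Sum.elim (fun j => kindOfEnds (D.l j) (D.r j))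
    fun k => .finite (μ k)
  let rev' : D.J ⊕ J → Bool := Sum.elim D.r fun _ => true
  let e' : D.J ⊕ J → ℕ → H := Sum.elim D.e fun k i => D.incl (e k i)
  have hlen' : ∀ j, 0 < len' j := by
    rintro (j | k)
    · exact h.len_pos j
    · exact e1 k
  have hind : LinearIndependent ℂ (fun p : Σ j, Fin (len' j) => e' p.1 p.2) := by
    refine linearIndependent_sigma fun c hc => ?_
    rw [sum_elim_comb] at hc
    have h1 := h.indep (fun j => c (Sum.inl j)) _ (by rw [D.comb_apply]; exact hc)
    have h2 := e2 (fun k => c (Sum.inr k)) h1.2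
    rintro (j | k) i hi
    · exact h1.1 j i hi
    · exact h2 k i hi
  refine exists_isChainDecomp_of_family (J := {j // kind' j = .shift → 1 < len' j})
    (fun j => kind' j) (fun j => len' j) (fun j => rev' j) (fun j => e' j) (fun j => hlen' j)
    (fun j => j.2) (hind.comp (fun p : Σ j : {j // kind' j = .shift → 1 < len' j}, Fin (len' j) =>
      (⟨p.1.1, p.2⟩ : Σ j, Fin (len' j))) ?_) ?_ ?_
  · rintro ⟨⟨j, hj⟩, i⟩ ⟨⟨j', hj'⟩, i'⟩ heq
    obtain ⟨h1, h2⟩ := Sigma.mk.inj heq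
    simp only at h1
    subst h1
    obtain rfl := eq_of_heq h2
    rfl
  · rintro ⟨j | k, hj⟩
    · exact (chainPairs_subset_iff (h.len_pos j) (D.l j) (D.r j) (D.e j) A).2
        ⟨h.pairs.arrow j, h.pairs.left j, h.pairs.right j⟩
    · refine (chainPairs_finite_subset_iff (e1 k) (μ k) (fun i => D.incl (e k i)) A).2
        ⟨fun i hi => ?_, ?_⟩
      · have := h.pairs.unit (e k i)
        have h4 := e4 k i hi
        rw [LinearEquiv.coe_coe] at h4
        rwa [h4, map_add, map_smul] at this
      · have := h.pairs.unit (e k (len k - 1))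
        have h5 := e5 k
        rw [LinearEquiv.coe_coe] at h5
        rwa [h5, map_smul] at this
  · intro Q hQ
    have hJ : ∀ j : D.J, (kindOfEnds (D.l j) (D.r j) = .shift → 1 < D.len j) → _ := fun j hj =>
      (chainPairs_subset_iff (h.len_pos j) (D.l j) (D.r j) (D.e j) Q).1 (hQ ⟨Sum.inl j, hj⟩)
    refine h.gen Q ⟨fun j i hi => (hJ j fun _ => by omega).1 i hi,
      fun j hl => (hJ j fun hk => ?_).2.1 hl, fun j hr => (hJ j fun hk => ?_).2.2 hr, fun w => ?_⟩
    · cases hr : D.r j <;> rw [hl, hr] at hk <;> cases hk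
    · cases hl : D.l j <;> rw [hl, hr] at hk <;> cases hk
    · have h1 := e3 (Q.comap (D.incl.prod (D.incl ∘ₗ (D.T : (Fin D.m → ℂ) →ₗ[ℂ] _)))) ?_
      · have h2 : w ∈ Q.comap (D.incl.prod (D.incl ∘ₗ (D.T : (Fin D.m → ℂ) →ₗ[ℂ] _))) := by
          rw [h1]; trivial
        exact h2
      · intro k i hi
        have hk := (chainPairs_finite_subset_iff (e1 k) (μ k) (fun i => D.incl (e k i)) Q).1
          (hQ ⟨Sum.inr k, fun hk => by cases hk⟩)
        change (D.incl (e k i), D.incl ((D.T : (Fin D.m → ℂ) →ₗ[ℂ] _) (e k i))) ∈ Q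
        by_cases hi' : i + 1 < len k
        · rw [e4 k i hi', map_add, map_smul]
          exact hk.1 i hi'
        · obtain rfl : i = len k - 1 := by omega
          rw [e5 k, map_smul]
          exact hk.2

end Conversion

/-! ### Uniqueness of the chain structure -/

section Reindex

variable {H : Type*} [AddCommGroup H]

/-- The chains `x'`, renumbered by `σ`.  The use of `entry` avoids a cast between index types; `σ`
is applied only where it preserves the lengths of the chains. -/
def reindex {s s' : ChainShape} (σ : Fin s.num ≃ Fin s'.num) (x' : s'.Index → H) : s.Index → H :=
  fun p => entry s' x' (σ p.1) (p.2 + 1)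

theorem entry_reindex {s s' : ChainShape} {x' : s'.Index → H} {σ : Fin s.num ≃ Fin s'.num}
    (hσ : ∀ j, s'.kind (σ j) = s.kind j ∧ s'.len (σ j) = s.len j)
    (j : Fin s.num) (k : ℕ) : entry s (reindex σ x') j k = entry s' x' (σ j) k := by
  by_cases hk : 1 ≤ k ∧ k ≤ s.len j
  · rw [entry, dif_pos hk, reindex]
    simp only
    rw [Nat.sub_add_cancel hk.1]
  · rw [entry, dif_neg hk, entry, dif_neg]
    rwa [(hσ j).2]

end Reindex

section Uniqueness

/-- Two chain structures with the same number of chains of each type and of more than `k` vectors,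
for all `k`, differ only by the numbering of the chains. -/
theorem exists_equiv_of_card_eq (s s' : ChainShape)
    (hcard : ∀ κ k, Nat.card {j : Fin s.num // s.kind j = κ ∧ k < s.len j} =
      Nat.card {j : Fin s'.num // s'.kind j = κ ∧ k < s'.len j}) :
    ∃ σ : Fin s.num ≃ Fin s'.num, ∀ j, s'.kind (σ j) = s.kind j ∧ s'.len (σ j) = s.len j := by
  classical
  have hsplit : ∀ (s : ChainShape) κ k, Nat.card {j : Fin s.num // s.kind j = κ ∧ k < s.len j} =
      Nat.card {j : Fin s.num // (s.kind j, s.len j) = (κ, k + 1)} +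
        Nat.card {j : Fin s.num // s.kind j = κ ∧ k + 1 < s.len j} := by
    intro s κ k
    simp only [Nat.card_eq_fintype_card, Fintype.card_subtype]
    rw [← Finset.card_union_of_disjoint]
    · congr 1
      ext j
      simp only [Finset.mem_filter, Finset.mem_univ, true_and, Finset.mem_union, Prod.mk.injEq,
        ← and_or_left]
      refine and_congr_right fun _ => ?_
      omega
    · rw [Finset.disjoint_filter]
      intro j _ h1 h2
      have := (Prod.mk.inj h1).2
      omega
  have hfib : ∀ c : PartKind × ℕ, Nonempty ({j : Fin s.num // (s.kind j, s.len j) = c} ≃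
      {j : Fin s'.num // (s'.kind j, s'.len j) = c}) := by
    rintro ⟨κ, n⟩
    refine Finite.card_eq.1 ?_
    rcases n with _ | k
    · have : ∀ s : ChainShape, IsEmpty {j : Fin s.num // (s.kind j, s.len j) = (κ, 0)} := fun s =>
        ⟨fun j => absurd (Prod.mk.inj j.2).2 (s.len_pos j).ne'⟩
      have h1 := this s
      have h2 := this s'
      rw [Nat.card_of_isEmpty, Nat.card_of_isEmpty]
    · have h1 := hsplit s κ k
      have h2 := hsplit s' κ k
      have h3 := hcard κ k
      have h4 := hcard κ (k + 1)
      omega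
  let σ := Equiv.ofFiberEquiv fun c => (hfib c).some
  refine ⟨σ, fun j => ?_⟩
  have := Equiv.ofFiberEquiv_map (fun c => (hfib c).some) j
  exact Prod.mk.inj this

variable {H : Type*} [AddCommGroup H] [Module ℂ H]

theorem quotDim_eq_of_weyr_eq {A A' : LinRel H} (hW : weyr A = weyr A') (κ : PartKind) (k : ℕ) :
    quotDim A κ k = quotDim A' κ k := by
  rcases κ with _ | z | _ | _
  · exact congrFun (congrArg WeyrData.B hW) k
  · exact congrFun (congrFun (congrArg WeyrData.W hW) z) k
  · exact congrFun (congrArg WeyrData.A hW) k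
  · exact congrFun (congrArg WeyrData.C hW) k

theorem exists_equiv_of_weyr_eq {A A' : LinRel H} (hW : weyr A = weyr A') {s s' : ChainShape}
    {x : s.Index → H} {x' : s'.Index → H} (h : IsChainDecomp A s x) (h' : IsChainDecomp A' s' x') :
    ∃ σ : Fin s.num ≃ Fin s'.num, ∀ j, s'.kind (σ j) = s.kind j ∧ s'.len (σ j) = s.len j :=
  exists_equiv_of_card_eq s s' fun κ k => by
    rw [← h.quotDim_eq, ← h'.quotDim_eq, quotDim_eq_of_weyr_eq hW]

variable {s s' : ChainShape} {x' : s'.Index → H} {σ : Fin s.num ≃ Fin s'.num}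

theorem chainSpace_reindex (hσ : ∀ j, s'.kind (σ j) = s.kind j ∧ s'.len (σ j) = s.len j)
    (κ : PartKind) : chainSpace s (reindex σ x') κ = chainSpace s' x' κ := by
  rw [chainSpace_eq_posSpan, chainSpace_eq_posSpan]
  refine le_antisymm (posSpan_le fun j k hj _ _ => ?_) (posSpan_le fun j k hj _ _ => ?_)
  · rw [entry_reindex hσ]
    exact entry_mem_posSpan (P := fun j _ => s'.kind j = κ) ((hσ j).1.trans hj)
  · obtain ⟨i, rfl⟩ := σ.surjective j
    rw [← entry_reindex hσ]
    exact entry_mem_posSpan (P := fun j _ => s.kind j = κ) ((hσ i).1.symm.trans hj)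

theorem chainRel_reindex (hσ : ∀ j, s'.kind (σ j) = s.kind j ∧ s'.len (σ j) = s.len j)
    (κ : PartKind) : chainRel s (reindex σ x') κ = chainRel s' x' κ := by
  have he : ∀ j, entry s (reindex σ x') j = entry s' x' (σ j) := fun j =>
    funext (entry_reindex hσ j)
  refine le_antisymm (chainRel_le fun j hj p hp => ?_) (chainRel_le fun j hj p hp => ?_)
  · refine mem_chainRel (j := σ j) ((hσ j).1.trans hj) ?_
    rwa [← he, (hσ j).2]
  · obtain ⟨i, rfl⟩ := σ.surjective j
    refine mem_chainRel (j := i) ((hσ i).1.symm.trans hj) ?_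
    rwa [he, ← (hσ i).2]

theorem IsChainDecomp.reindex {A' : LinRel H} (h' : IsChainDecomp A' s' x')
    (hσ : ∀ j, s'.kind (σ j) = s.kind j ∧ s'.len (σ j) = s.len j) :
    IsChainDecomp A' s (reindex σ x') where
  independent := by
    let φ : s.Index → s'.Index := fun p => ⟨σ p.1, ⟨p.2, p.2.2.trans_eq (hσ p.1).2.symm⟩⟩
    have hφ : Function.Injective φ := by
      rintro ⟨j, i⟩ ⟨j', i'⟩ h
      obtain ⟨h1, h2⟩ := Sigma.mk.inj h
      obtain rfl := σ.injective h1
      have h3 := congrArg Fin.val (eq_of_heq h2)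
      obtain rfl : i = i' := Fin.ext h3
      rfl
    have hx : LinRel.reindex σ x' = x' ∘ φ := by
      funext p
      exact entry_succ (φ p)
    rw [hx]
    exact h'.independent.comp φ hφ
  support_eq := by
    rw [← h'.support_eq]
    exact iSup_congr (chainSpace_reindex hσ)
  rel_eq := h'.rel_eq.trans (iSup_congr fun κ => (chainRel_reindex hσ κ).symm)

theorem sumExtend_inl {ι : Type*} {x : ι → H} (hx : LinearIndependent ℂ x) (i : ι) :
    Module.Basis.sumExtend hx (Sum.inl i) = x i := by
  classical
  simp only [Module.Basis.sumExtend, Module.Basis.reindex_apply]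
  rw [Module.Basis.extend_apply_self]
  rfl

/-- Two linearly independent families with the same index set differ by an automorphism. -/
theorem exists_linearEquiv_of_linearIndependent [FiniteDimensional ℂ H] {ι : Type*} {x y : ι → H}
    (hx : LinearIndependent ℂ x) (hy : LinearIndependent ℂ y) :
    ∃ T : H ≃ₗ[ℂ] H, ∀ i, T (x i) = y i := by
  have := hx.finite
  let bx := Module.Basis.sumExtend hx
  let b_y := Module.Basis.sumExtend hy
  have f1 := Module.Finite.finite_basis bx
  have f2 := Module.Finite.finite_basis b_y
  have g1 := Finite.sum_right ι (β := Module.Basis.sumExtendIndex hx)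
  have g2 := Finite.sum_right ι (β := Module.Basis.sumExtendIndex hy)
  have hc : Nat.card (Module.Basis.sumExtendIndex hx) =
      Nat.card (Module.Basis.sumExtendIndex hy) := by
    have h1 := Module.finrank_eq_nat_card_basis bx
    have h2 := Module.finrank_eq_nat_card_basis b_y
    rw [Nat.card_sum] at h1 h2
    omega
  obtain ⟨ε⟩ := Finite.card_eq.1 hc
  refine ⟨bx.equiv b_y (Equiv.sumCongr (Equiv.refl ι) ε), fun i => ?_⟩
  have h1 := sumExtend_inl hx i
  have h2 := sumExtend_inl hy i
  rw [← h1, ← h2]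
  change bx.equiv b_y _ (bx (Sum.inl i)) = b_y (Sum.inl i)
  rw [Module.Basis.equiv_apply, Equiv.sumCongr_apply, Sum.map_inl, Equiv.refl_apply]

theorem map_entry {x y : s.Index → H} {T : H ≃ₗ[ℂ] H} (hT : ∀ i, T (x i) = y i) (j : Fin s.num)
    (k : ℕ) : T (entry s x j k) = entry s y j k := by
  by_cases hk : 1 ≤ k ∧ k ≤ s.len j
  · rw [entry, dif_pos hk, entry, dif_pos hk, hT]
  · rw [entry, dif_neg hk, entry, dif_neg hk, map_zero]

theorem map_chainSpace {x y : s.Index → H} {T : H ≃ₗ[ℂ] H} (hT : ∀ i, T (x i) = y i)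
    (κ : PartKind) : (chainSpace s x κ).map (T : H →ₗ[ℂ] H) = chainSpace s y κ := by
  rw [chainSpace, chainSpace, Submodule.map_span]
  congr 1
  ext v
  constructor
  · rintro ⟨_, ⟨i, hi, rfl⟩, rfl⟩
    exact ⟨i, hi, hT i⟩
  · rintro ⟨i, hi, rfl⟩
    exact ⟨x i, ⟨i, hi, rfl⟩, hT i⟩

theorem map_chainPairs (n : ℕ) (e : ℕ → H) (T : H →ₗ[ℂ] H) (κ : PartKind) :
    (T.prodMap T) '' chainPairs n e κ = chainPairs n (fun k => T (e k)) κ := by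
  ext p
  cases κ <;> constructor
  · rintro ⟨_, ⟨k, hk, rfl⟩, rfl⟩
    exact ⟨k, hk, rfl⟩
  · rintro ⟨k, hk, rfl⟩
    exact ⟨_, ⟨k, hk, rfl⟩, rfl⟩
  · rintro ⟨_, ⟨k, hk, rfl⟩, rfl⟩
    exact ⟨k, hk, by simp⟩
  · rintro ⟨k, hk, rfl⟩
    exact ⟨_, ⟨k, hk, rfl⟩, by simp⟩
  · rintro ⟨_, ⟨k, hk, rfl⟩, rfl⟩
    exact ⟨k, hk, rfl⟩
  · rintro ⟨k, hk, rfl⟩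
    exact ⟨_, ⟨k, hk, rfl⟩, rfl⟩
  · rintro ⟨_, ⟨k, hk, hk', rfl⟩, rfl⟩
    exact ⟨k, hk, hk', rfl⟩
  · rintro ⟨k, hk, hk', rfl⟩
    exact ⟨_, ⟨k, hk, hk', rfl⟩, rfl⟩

theorem map_chainRel {x y : s.Index → H} {T : H ≃ₗ[ℂ] H} (hT : ∀ i, T (x i) = y i)
    (κ : PartKind) :
    (chainRel s x κ).map (LinearMap.prodMap (T : H →ₗ[ℂ] H) (T : H →ₗ[ℂ] H)) =
      chainRel s y κ := by
  have he : ∀ j, (fun k => (T : H →ₗ[ℂ] H) (entry s x j k)) = entry s y j := fun j =>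
    funext (map_entry hT j)
  refine le_antisymm (Submodule.map_le_iff_le_comap.2 (chainRel_le fun j hj p hp => ?_))
    (chainRel_le fun j hj p hp => ?_)
  · refine mem_chainRel hj ?_
    rw [← he, ← map_chainPairs]
    exact ⟨p, hp, rfl⟩
  · rw [← he, ← map_chainPairs] at hp
    obtain ⟨q, hq, rfl⟩ := hp
    exact ⟨q, mem_chainRel hj hq, rfl⟩

theorem properPointSpectrum_eq {A A' : LinRel H} {x y : s.Index → H} (h : IsChainDecomp A s x)
    (h' : IsChainDecomp A' s y) : properPointSpectrum A = properPointSpectrum A' := by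
  ext w
  induction w using OnePoint.rec with
  | infty => rw [h.infty_mem_properPointSpectrum_iff, h'.infty_mem_properPointSpectrum_iff]
  | coe z => rw [h.coe_mem_properPointSpectrum_iff, h'.coe_mem_properPointSpectrum_iff]

end Uniqueness

end LinRel

theorem proposition6p4 {H : Type*} [AddCommGroup H] [Module ℂ H] [FiniteDimensional ℂ H]
    (A A' : LinRel H) (hW : LinRel.weyr A = LinRel.weyr A') :
    -- the proper eigenvalues coincide
    LinRel.properPointSpectrum A = LinRel.properPointSpectrum A' ∧
    -- both relations have a Jordan-like decomposition with one and the same chain structure,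
    -- given by the common Weyr characteristic
    (∃ (s : LinRel.ChainShape) (x x' : s.Index → H),
      LinRel.IsWeyrJordanLike A s x ∧ LinRel.IsWeyrJordanLike A' s x') ∧
    -- any Jordan-like decompositions of the two relations have the same chain structure, and
    -- a linear change of coordinates carries chains, spaces and parts into each other
    (∀ (s s' : LinRel.ChainShape) (x : s.Index → H) (x' : s'.Index → H),
      LinRel.IsJordanLike A s x → LinRel.IsJordanLike A' s' x' →
      ∃ (σ : Fin s.num ≃ Fin s'.num) (T : H ≃ₗ[ℂ] H),
        (∀ j, s'.kind (σ j) = s.kind j ∧ s'.len (σ j) = s.len j) ∧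
        (∀ j k, T (LinRel.entry s x j k) = LinRel.entry s' x' (σ j) k) ∧
        (∀ κ, Submodule.map (T : H →ₗ[ℂ] H) (LinRel.chainSpace s x κ)
          = LinRel.chainSpace s' x' κ) ∧
        (∀ κ, Submodule.map (LinearMap.prodMap (T : H →ₗ[ℂ] H) (T : H →ₗ[ℂ] H))
            (LinRel.restrict A (LinRel.chainSpace s x κ))
          = LinRel.restrict A' (LinRel.chainSpace s' x' κ))) := by
  obtain ⟨s, x, h⟩ := LinRel.exists_isChainDecomp A
  obtain ⟨s', x', h'⟩ := LinRel.exists_isChainDecomp A'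
  obtain ⟨σ, hσ⟩ := LinRel.exists_equiv_of_weyr_eq hW h h'
  refine ⟨LinRel.properPointSpectrum_eq h (h'.reindex hσ),
    ⟨s, x, LinRel.reindex σ x', h.isWeyrJordanLike, (h'.reindex hσ).isWeyrJordanLike⟩, ?_⟩
  intro s s' x x' hx hx'
  have h := hx.isChainDecomp
  have h' := hx'.isChainDecomp
  obtain ⟨σ, hσ⟩ := LinRel.exists_equiv_of_weyr_eq hW h h'
  obtain ⟨T, hT⟩ := LinRel.exists_linearEquiv_of_linearIndependent h.independent
    (h'.reindex hσ).independent
  refine ⟨σ, T, hσ, fun j k => ?_, fun κ => ?_, fun κ => ?_⟩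
  · rw [LinRel.map_entry hT, LinRel.entry_reindex hσ]
  · rw [LinRel.map_chainSpace hT, LinRel.chainSpace_reindex hσ]
  · rw [hx.part_eq, hx'.part_eq, LinRel.map_chainRel hT, LinRel.chainRel_reindex hσ]
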